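/- Let $\Omega\subset\mathbb{R}^2$ be a nonempty bounded open convex set and let $\omega>0$. For $(x_0,y_0)\in\mathbb{R}^2$ let $H_\omega(x_0,y_0)$ be the self-adjoint operator in $L^2(\Omega)$ obtained as the Friedrichs extension of \[ -\Delta+i\omega\bigl((x-x_0)\partial_y-(y-y_0)\partial_x\bigr)\quad\text{on } C_0^\infty(\Omega), \] that is, the Dirichlet Hamiltonian of a particle confined to $\Omega$ rotating around the point $(x_0,y_0)$ with angular velocity $\omega$. Then for every $(x_0,y_0)\in\mathbb{R}^2$ the operator $H_\omega(x_0,y_0)$ has a lowest eigenvalue $\lambda_1^\omega(x_0,y_0)$, and the function $(x_0,y_0)\mapsto\lambda_1^\omega(x_0,y_0)$ on $\mathbb{R}^2$ attains its maximum at a point of $\Omega$. Moreover, every point of $\mathbb{R}^2$ at which this maximum is attained belongs to the open set $\Omega$; in particular, the maximum is attained neither outside $\Omega$ nor on its boundary. -/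

import Mathlib

open MeasureTheory Filter TopologicalSpace LineDeriv
open scoped Topology Distributions LinearPMap

noncomputable section

namespace RotatingFrame

/-! ### Friedrichs extension and eigenvalues of an unbounded operator -/

section Abstract

/-- `T` is symmetric and bounded from below: `⟪T u, v⟫ = ⟪u, T v⟫` and
`⟪T u, u⟫ ≥ -m ‖u‖²` on the domain of `T`, for some real `m`. -/
structure IsSemibounded {H : Type*} [NormedAddCommGroup H] [InnerProductSpace ℂ H]
    (T : H →ₗ.[ℂ] H) : Prop where
  symm : T.IsFormalAdjoint T
  bound : ∃ m : ℝ, ∀ u : T.domain, -m * ‖(u : H)‖ ^ 2 ≤ (inner ℂ (T u) (u : H)).re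

/-- The quadratic form `⟪T u, u⟫` of `T` (its real part, the imaginary part being zero when `T`
is symmetric). -/
def quadForm {H : Type*} [NormedAddCommGroup H] [InnerProductSpace ℂ H]
    (T : H →ₗ.[ℂ] H) (u : T.domain) : ℝ :=
  (inner ℂ (T u) (u : H)).re

/-- `u` is the norm limit of a sequence in the domain of `T` that is Cauchy for the quadratic
form of `T`. -/
def IsFormLimit {H : Type*} [NormedAddCommGroup H] [InnerProductSpace ℂ H]
    (T : H →ₗ.[ℂ] H) (u : H) : Prop :=
  ∃ s : ℕ → T.domain, Tendsto (fun n => (s n : H)) atTop (𝓝 u) ∧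
    Tendsto (fun p : ℕ × ℕ => quadForm T (s p.1 - s p.2)) atTop (𝓝 0)

theorem quadForm_parallelogram {H : Type*} [NormedAddCommGroup H] [InnerProductSpace ℂ H]
    (T : H →ₗ.[ℂ] H) (a b : T.domain) :
    quadForm T (a + b) + quadForm T (a - b) = 2 * quadForm T a + 2 * quadForm T b := by
  simp only [quadForm, LinearPMap.map_add, LinearPMap.map_sub, Submodule.coe_add,
    Submodule.coe_sub, inner_add_left, inner_add_right, inner_sub_left, inner_sub_right,
    Complex.add_re, Complex.sub_re]
  ring

theorem quadForm_smul {H : Type*} [NormedAddCommGroup H] [InnerProductSpace ℂ H]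
    (T : H →ₗ.[ℂ] H) (z : ℂ) (a : T.domain) :
    quadForm T (z • a) = ‖z‖ ^ 2 * quadForm T a := by
  simp only [quadForm, LinearPMap.map_smul, Submodule.coe_smul, inner_smul_left,
    inner_smul_right]
  rw [← mul_assoc, Complex.mul_conj, Complex.re_ofReal_mul, Complex.normSq_eq_norm_sq]

theorem IsFormLimit.add {H : Type*} [NormedAddCommGroup H] [InnerProductSpace ℂ H]
    {T : H →ₗ.[ℂ] H} (hT : IsSemibounded T) {u v : H}
    (hu : IsFormLimit T u) (hv : IsFormLimit T v) : IsFormLimit T (u + v) := by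
  obtain ⟨s, hs, hsq⟩ := hu
  obtain ⟨t, ht, htq⟩ := hv
  obtain ⟨m, hm⟩ := hT.bound
  refine ⟨fun n => s n + t n, by simpa using hs.add ht, ?_⟩
  have h1 : Tendsto (fun p : ℕ × ℕ => p.1) atTop atTop := by
    rw [← prod_atTop_atTop_eq]; exact tendsto_fst
  have h2 : Tendsto (fun p : ℕ × ℕ => p.2) atTop atTop := by
    rw [← prod_atTop_atTop_eq]; exact tendsto_snd
  have hs0 : Tendsto (fun p : ℕ × ℕ => ((s p.1 : H) - s p.2)) atTop (𝓝 0) := by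
    simpa using (hs.comp h1).sub (hs.comp h2)
  have ht0 : Tendsto (fun p : ℕ × ℕ => ((t p.1 : H) - t p.2)) atTop (𝓝 0) := by
    simpa using (ht.comp h1).sub (ht.comp h2)
  have hlow : Tendsto (fun p : ℕ × ℕ => -m * ‖((s p.1 : H) - s p.2) + ((t p.1 : H) - t p.2)‖ ^ 2)
      atTop (𝓝 0) := by
    simpa using (((hs0.add ht0).norm).pow 2).const_mul (-m)
  have hupp : Tendsto (fun p : ℕ × ℕ => 2 * quadForm T (s p.1 - s p.2)
      + 2 * quadForm T (t p.1 - t p.2)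
      + m * ‖((s p.1 : H) - s p.2) - ((t p.1 : H) - t p.2)‖ ^ 2) atTop (𝓝 0) := by
    simpa using ((hsq.const_mul 2).add (htq.const_mul 2)).add
      ((((hs0.sub ht0).norm).pow 2).const_mul m)
  refine tendsto_of_tendsto_of_tendsto_of_le_of_le hlow hupp (fun p => ?_) (fun p => ?_)
  · have := hm ((s p.1 - s p.2) + (t p.1 - t p.2))
    have e : s p.1 + t p.1 - (s p.2 + t p.2) = (s p.1 - s p.2) + (t p.1 - t p.2) := by abel
    simp only [e]
    simpa [quadForm] using this
  · have := hm ((s p.1 - s p.2) - (t p.1 - t p.2))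
    have e : s p.1 + t p.1 - (s p.2 + t p.2) = (s p.1 - s p.2) + (t p.1 - t p.2) := by abel
    have hp := quadForm_parallelogram T (s p.1 - s p.2) (t p.1 - t p.2)
    simp only [e]
    simp only [Submodule.coe_sub] at this
    change _ ≤ quadForm T _ at this
    linarith

theorem IsFormLimit.smul {H : Type*} [NormedAddCommGroup H] [InnerProductSpace ℂ H]
    {T : H →ₗ.[ℂ] H} (z : ℂ) {u : H} (hu : IsFormLimit T u) : IsFormLimit T (z • u) := by
  obtain ⟨s, hs, hsq⟩ := hu
  refine ⟨fun n => z • s n, by simpa using hs.const_smul z, ?_⟩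
  simp only [← smul_sub, quadForm_smul]
  simpa using hsq.const_mul (‖z‖ ^ 2)

/-- The domain of the closure of the quadratic form of a semibounded symmetric operator. -/
def formDomain {H : Type*} [NormedAddCommGroup H] [InnerProductSpace ℂ H]
    (T : H →ₗ.[ℂ] H) (hT : IsSemibounded T) : Submodule ℂ H where
  carrier := {u | IsFormLimit T u}
  add_mem' hu hv := hu.add hT hv
  zero_mem' := ⟨fun _ => 0, by simp, by simp [quadForm]⟩
  smul_mem' z _ hu := hu.smul z

/-- The Friedrichs extension of a densely defined semibounded symmetric operator `T`: the
restriction of the adjoint of `T` to the vectors that lie in the domain of the closed form. -/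
def friedrichs {H : Type*} [NormedAddCommGroup H] [InnerProductSpace ℂ H] [CompleteSpace H]
    (T : H →ₗ.[ℂ] H) (hT : IsSemibounded T) : H →ₗ.[ℂ] H :=
  T†.domRestrict (formDomain T hT)

/-- `μ` is an eigenvalue of the unbounded operator `A`. -/
def IsEigenvalue {H : Type*} [NormedAddCommGroup H] [InnerProductSpace ℂ H]
    (A : H →ₗ.[ℂ] H) (μ : ℂ) : Prop :=
  ∃ u : A.domain, (u : H) ≠ 0 ∧ A u = μ • (u : H)

end Abstract

/-! ### The rotating Hamiltonian -/

/-- The Euclidean plane; `p 0` and `p 1` are the coordinates `x` and `y` of `p`. -/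
abbrev Plane : Type := EuclideanSpace ℝ (Fin 2)

/-- The unit vector in the direction of the `x` axis. -/
abbrev ex : Plane := EuclideanSpace.single 0 1

/-- The unit vector in the direction of the `y` axis. -/
abbrev ey : Plane := EuclideanSpace.single 1 1

/-- The complex Hilbert space `L²(Ω)` with respect to Lebesgue measure on `Ω`. -/
abbrev L2 (Ω : Opens Plane) : Type := Lp ℂ 2 (volume.restrict (Ω : Set Plane))

/-- Multiplication of a test function by the real function `p ↦ p i - a`. -/
def mulCoord (Ω : Opens Plane) (i : Fin 2) (a : ℝ) : 𝓓(Ω, ℂ) →ₗ[ℂ] 𝓓(Ω, ℂ) where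
  toFun φ :=
    { toFun := fun p => ((p i - a : ℝ) : ℂ) * φ p
      contDiff' := by
        have h : ContDiff ℝ ((⊤ : ℕ∞) : WithTop ℕ∞) (fun p : Plane => p i - a) := by fun_prop
        exact (Complex.ofRealCLM.contDiff.comp h).mul φ.contDiff
      hasCompactSupport' := φ.hasCompactSupport.mul_left
      tsupport_subset' := (tsupport_mul_subset_right).trans φ.tsupport_subset }
  map_add' φ ψ := by
    ext p
    exact mul_add _ _ _
  map_smul' z φ := by
    ext p
    exact mul_left_comm _ _ _

/-- The partial derivative in the direction `v` of a test function. -/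
def partialDeriv (Ω : Opens Plane) (v : Plane) : 𝓓(Ω, ℂ) →ₗ[ℂ] 𝓓(Ω, ℂ) :=
  (TestFunction.lineDerivCLM ℂ v : 𝓓(Ω, ℂ) →L[ℂ] 𝓓(Ω, ℂ)).toLinearMap

theorem partialDeriv_apply (Ω : Opens Plane) (v : Plane) (φ : 𝓓(Ω, ℂ)) (p : Plane) :
    partialDeriv Ω v φ p = lineDeriv ℝ φ p v :=
  TestFunction.lineDerivCLM_apply_of_le (by simp)

/-- The differential expression
`φ ↦ -(∂ₓ² + ∂ᵧ²) φ + i ω ((x - x₀) ∂ᵧ φ - (y - y₀) ∂ₓ φ)` on the test functions on `Ω`, where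
`c = (x₀, y₀)` is the centre of rotation. -/
def rotExpr (Ω : Opens Plane) (ω : ℝ) (c : Plane) : 𝓓(Ω, ℂ) →ₗ[ℂ] 𝓓(Ω, ℂ) :=
  -(partialDeriv Ω ex ∘ₗ partialDeriv Ω ex + partialDeriv Ω ey ∘ₗ partialDeriv Ω ey)
    + (Complex.I * ω) • (mulCoord Ω 0 (c 0) ∘ₗ partialDeriv Ω ey
      - mulCoord Ω 1 (c 1) ∘ₗ partialDeriv Ω ex)

theorem memLp_testFunction (Ω : Opens Plane) (φ : 𝓓(Ω, ℂ)) :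
    MemLp φ 2 (volume.restrict (Ω : Set Plane)) :=
  (φ.continuous.memLp_of_hasCompactSupport φ.hasCompactSupport).restrict _

/-- The inclusion of the test functions on `Ω` into `L²(Ω)`. -/
def toL2 (Ω : Opens Plane) : 𝓓(Ω, ℂ) →ₗ[ℂ] L2 Ω where
  toFun φ := (memLp_testFunction Ω φ).toLp φ
  map_add' φ ψ := MemLp.toLp_add (memLp_testFunction Ω φ) (memLp_testFunction Ω ψ)
  map_smul' z φ := MemLp.toLp_const_smul z (memLp_testFunction Ω φ)

theorem coeFn_toL2 (Ω : Opens Plane) (φ : 𝓓(Ω, ℂ)) :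
    toL2 Ω φ =ᵐ[volume.restrict (Ω : Set Plane)] φ :=
  (memLp_testFunction Ω φ).coeFn_toLp

theorem eq_zero_of_notMem (Ω : Opens Plane) (φ : 𝓓(Ω, ℂ)) {p : Plane} (hp : p ∉ Ω) : φ p = 0 :=
  image_eq_zero_of_notMem_tsupport fun h => hp (φ.tsupport_subset h)

theorem toL2_injective (Ω : Opens Plane) : Function.Injective (toL2 Ω) := by
  intro φ ψ h
  have h1 : (φ : Plane → ℂ) =ᵐ[volume.restrict (Ω : Set Plane)] ψ := by
    refine (coeFn_toL2 Ω φ).symm.trans ?_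
    rw [h]
    exact coeFn_toL2 Ω ψ
  have h2 : Set.EqOn φ ψ (Ω : Set Plane) :=
    Measure.eqOn_open_of_ae_eq h1 Ω.isOpen φ.continuous.continuousOn ψ.continuous.continuousOn
  ext p
  by_cases hp : p ∈ Ω
  · exact h2 hp
  · rw [eq_zero_of_notMem Ω φ hp, eq_zero_of_notMem Ω ψ hp]

/-- The operator in `L²(Ω)` with domain `C₀^∞(Ω)` that acts as the differential expression
`rotExpr Ω ω c`. -/
def minimalHamiltonian (Ω : Opens Plane) (ω : ℝ) (c : Plane) : L2 Ω →ₗ.[ℂ] L2 Ω where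
  domain := LinearMap.range (toL2 Ω)
  toFun := toL2 Ω ∘ₗ rotExpr Ω ω c ∘ₗ
    (LinearEquiv.ofInjective (toL2 Ω) (toL2_injective Ω)).symm.toLinearMap

theorem minimalHamiltonian_apply (Ω : Opens Plane) (ω : ℝ) (c : Plane) (φ : 𝓓(Ω, ℂ)) :
    minimalHamiltonian Ω ω c ⟨toL2 Ω φ, LinearMap.mem_range_self _ φ⟩
      = toL2 Ω (rotExpr Ω ω c φ) := by
  have h : (LinearEquiv.ofInjective (toL2 Ω) (toL2_injective Ω)).symm
      ⟨toL2 Ω φ, LinearMap.mem_range_self _ φ⟩ = φ := by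
    rw [LinearEquiv.symm_apply_eq]
    rfl
  change toL2 Ω (rotExpr Ω ω c ((LinearEquiv.ofInjective (toL2 Ω) (toL2_injective Ω)).symm
    ⟨toL2 Ω φ, LinearMap.mem_range_self _ φ⟩)) = _
  rw [h]

/-- The operator is densely defined, so its adjoint is the usual one. -/
theorem minimalHamiltonian_dense (Ω : Opens Plane) (ω : ℝ) (c : Plane) :
    Dense ((minimalHamiltonian Ω ω c).domain : Set (L2 Ω)) := by
  change Dense ((LinearMap.range (toL2 Ω) : Submodule ℂ (L2 Ω)) : Set (L2 Ω))
  rw [Submodule.dense_iff_topologicalClosure_eq_top, Submodule.topologicalClosure_eq_top_iff,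
    Submodule.eq_bot_iff]
  intro f hf
  have hint : LocallyIntegrableOn f (Ω : Set Plane) (volume.restrict (Ω : Set Plane)) :=
    ((Lp.memLp f).locallyIntegrable (by norm_num)).locallyIntegrableOn _
  have h0 := Ω.isOpen.ae_eq_zero_of_integral_contDiff_smul_eq_zero hint (by
    intro g hg hgc hgs
    let φ : 𝓓(Ω, ℂ) :=
      { toFun := fun p => (g p : ℂ)
        contDiff' := Complex.ofRealCLM.contDiff.comp hg
        hasCompactSupport' := hgc.comp_left Complex.ofReal_zero
        tsupport_subset' := (tsupport_comp_subset Complex.ofReal_zero g).trans hgs }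
    have h1 := (Submodule.mem_orthogonal _ f).1 hf (toL2 Ω φ) (LinearMap.mem_range_self _ φ)
    rw [L2.inner_def] at h1
    rw [← h1]
    refine integral_congr_ae ?_
    filter_upwards [coeFn_toL2 Ω φ] with p hp
    rw [hp, RCLike.inner_apply]
    change g p • f p = f p * (starRingEnd ℂ) (g p : ℂ)
    rw [Complex.conj_ofReal, Complex.real_smul, mul_comm])
  refine Lp.ext ?_
  filter_upwards [h0, ae_restrict_mem Ω.isOpen.measurableSet, Lp.coeFn_zero ℂ 2
    (volume.restrict (Ω : Set Plane))] with p h1 h2 h3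
  rw [h1 h2, h3, Pi.zero_apply]

theorem inner_toL2 (Ω : Opens Plane) (φ ψ : 𝓓(Ω, ℂ)) :
    inner ℂ (toL2 Ω φ) (toL2 Ω ψ) = ∫ p, (starRingEnd ℂ) (φ p) * ψ p := by
  rw [L2.inner_def]
  have h : ∀ᵐ p ∂(volume.restrict (Ω : Set Plane)),
      inner ℂ (toL2 Ω φ p) (toL2 Ω ψ p) = (starRingEnd ℂ) (φ p) * ψ p := by
    filter_upwards [coeFn_toL2 Ω φ, coeFn_toL2 Ω ψ] with p h1 h2
    rw [h1, h2, RCLike.inner_apply, mul_comm]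
  rw [integral_congr_ae h]
  refine setIntegral_eq_integral_of_forall_compl_eq_zero fun p hp => ?_
  rw [eq_zero_of_notMem Ω ψ hp, mul_zero]

theorem integrable_conj_mul (Ω : Opens Plane) (φ ψ : 𝓓(Ω, ℂ)) :
    Integrable (fun p => (starRingEnd ℂ) (φ p) * ψ p) := by
  refine Continuous.integrable_of_hasCompactSupport ?_ ψ.hasCompactSupport.mul_left
  exact (Complex.continuous_conj.comp φ.continuous).mul ψ.continuous

theorem hasLineDerivAt_testFunction (Ω : Opens Plane) (v : Plane) (φ : 𝓓(Ω, ℂ)) (p : Plane) :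
    HasLineDerivAt ℝ φ (partialDeriv Ω v φ p) p v := by
  rw [partialDeriv_apply]
  exact ((φ.contDiff.differentiable (by simp)).differentiableAt).lineDifferentiableAt.hasLineDerivAt

theorem inner_partialDeriv (Ω : Opens Plane) (v : Plane) (φ ψ : 𝓓(Ω, ℂ)) :
    inner ℂ (toL2 Ω (partialDeriv Ω v φ)) (toL2 Ω ψ)
      = -inner ℂ (toL2 Ω φ) (toL2 Ω (partialDeriv Ω v ψ)) := by
  rw [inner_toL2, inner_toL2, eq_neg_iff_add_eq_zero, add_comm, ← eq_neg_iff_add_eq_zero]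
  exact integral_bilinear_hasLineDerivAt_right_eq_neg_left_of_integrable
    (B := (ContinuousLinearMap.mul ℝ ℂ).comp (Complex.conjCLE : ℂ →L[ℝ] ℂ))
    (integrable_conj_mul Ω _ _) (integrable_conj_mul Ω _ _) (integrable_conj_mul Ω _ _)
    (fun p _ => hasLineDerivAt_testFunction Ω v φ p)
    (fun p _ => hasLineDerivAt_testFunction Ω v ψ p)

theorem inner_mulCoord (Ω : Opens Plane) (i : Fin 2) (a : ℝ) (φ ψ : 𝓓(Ω, ℂ)) :
    inner ℂ (toL2 Ω (mulCoord Ω i a φ)) (toL2 Ω ψ)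
      = inner ℂ (toL2 Ω φ) (toL2 Ω (mulCoord Ω i a ψ)) := by
  rw [inner_toL2, inner_toL2]
  congr 1 with p
  change (starRingEnd ℂ) (((p i - a : ℝ) : ℂ) * φ p) * ψ p
    = (starRingEnd ℂ) (φ p) * (((p i - a : ℝ) : ℂ) * ψ p)
  rw [map_mul, Complex.conj_ofReal]
  ring

/-- Differentiation along one coordinate axis commutes with multiplication by the other
coordinate. -/
theorem partialDeriv_mulCoord (Ω : Opens Plane) (i j : Fin 2) (hij : i ≠ j) (a : ℝ)
    (φ : 𝓓(Ω, ℂ)) :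
    partialDeriv Ω (EuclideanSpace.single j 1) (mulCoord Ω i a φ)
      = mulCoord Ω i a (partialDeriv Ω (EuclideanSpace.single j 1) φ) := by
  ext p
  rw [partialDeriv_apply]
  refine HasLineDerivAt.lineDeriv ?_
  have h := hasLineDerivAt_testFunction Ω (EuclideanSpace.single j 1) φ p
  have h' := HasDerivAt.const_mul ((p i - a : ℝ) : ℂ) h
  change HasDerivAt (fun t : ℝ => (((p + t • EuclideanSpace.single j (1 : ℝ)) i - a : ℝ) : ℂ)
    * φ (p + t • EuclideanSpace.single j (1 : ℝ))) _ 0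
  change HasDerivAt _ (((p i - a : ℝ) : ℂ) * partialDeriv Ω (EuclideanSpace.single j 1) φ p) 0
  simpa [hij] using h'

theorem norm_mulCoord_le (Ω : Opens Plane) (i : Fin 2) (a R : ℝ)
    (hR : ∀ p ∈ Ω, |p i - a| ≤ R) (φ : 𝓓(Ω, ℂ)) :
    ‖toL2 Ω (mulCoord Ω i a φ)‖ ≤ R * ‖toL2 Ω φ‖ := by
  refine Lp.norm_le_mul_norm_of_ae_le_mul ?_
  filter_upwards [coeFn_toL2 Ω φ, coeFn_toL2 Ω (mulCoord Ω i a φ),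
    ae_restrict_mem Ω.isOpen.measurableSet] with p h1 h2 hp
  rw [h1, h2]
  change ‖((p i - a : ℝ) : ℂ) * φ p‖ ≤ _
  rw [norm_mul, Complex.norm_real, Real.norm_eq_abs]
  exact mul_le_mul_of_nonneg_right (hR p hp) (norm_nonneg _)

theorem minimalHamiltonian_symm (Ω : Opens Plane) (ω : ℝ) (c : Plane) :
    (minimalHamiltonian Ω ω c).IsFormalAdjoint (minimalHamiltonian Ω ω c) := by
  rintro ⟨_, φ, rfl⟩ ⟨_, ψ, rfl⟩
  rw [minimalHamiltonian_apply, minimalHamiltonian_apply]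
  have e1 := partialDeriv_mulCoord Ω 0 1 (by decide) (c 0) ψ
  have e2 := partialDeriv_mulCoord Ω 1 0 (by decide) (c 1) ψ
  simp only [rotExpr, LinearMap.add_apply, LinearMap.neg_apply, LinearMap.smul_apply,
    LinearMap.sub_apply, LinearMap.comp_apply, map_add, map_neg, map_sub, map_smul,
    inner_add_left, inner_add_right, inner_neg_left, inner_neg_right, inner_sub_left,
    inner_sub_right, inner_smul_left, inner_smul_right, inner_partialDeriv, inner_mulCoord,
    e1, e2, map_mul, Complex.conj_I, Complex.conj_ofReal]
  ring

theorem minimalHamiltonian_semibounded (Ω : Opens Plane)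
    (hb : Bornology.IsBounded (Ω : Set Plane)) (ω : ℝ) (c : Plane) :
    IsSemibounded (minimalHamiltonian Ω ω c) := by
  refine ⟨minimalHamiltonian_symm Ω ω c, ?_⟩
  obtain ⟨R, hR0, hR⟩ := hb.subset_closedBall_lt 0 c
  have hR' : ∀ i : Fin 2, ∀ p ∈ Ω, |p i - c i| ≤ R := by
    intro i p hp
    have h1 := hR hp
    rw [Metric.mem_closedBall, dist_eq_norm] at h1
    exact (PiLp.norm_apply_le (p - c) i).trans h1
  refine ⟨ω ^ 2 * R ^ 2, ?_⟩
  rintro ⟨_, φ, rfl⟩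
  rw [minimalHamiltonian_apply]
  set F := toL2 Ω φ with hF
  set X := toL2 Ω (partialDeriv Ω ex φ) with hX
  set Y := toL2 Ω (partialDeriv Ω ey φ) with hY
  set M0 := toL2 Ω (mulCoord Ω 0 (c 0) φ) with hM0
  set M1 := toL2 Ω (mulCoord Ω 1 (c 1) φ) with hM1
  have b0 : ‖M0‖ ≤ R * ‖F‖ := norm_mulCoord_le Ω 0 (c 0) R (hR' 0) φ
  have b1 : ‖M1‖ ≤ R * ‖F‖ := norm_mulCoord_le Ω 1 (c 1) R (hR' 1) φ
  have key : inner ℂ (toL2 Ω (rotExpr Ω ω c φ)) F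
      = inner ℂ X X + inner ℂ Y Y
        + (-(Complex.I * ω)) * (inner ℂ Y M0 - inner ℂ X M1) := by
    simp only [rotExpr, LinearMap.add_apply, LinearMap.neg_apply, LinearMap.smul_apply,
      LinearMap.sub_apply, LinearMap.comp_apply, map_add, map_neg, map_sub, map_smul,
      inner_add_left, inner_neg_left, inner_sub_left, inner_smul_left, hF,
      inner_partialDeriv Ω ex (partialDeriv Ω ex φ), inner_partialDeriv Ω ey (partialDeriv Ω ey φ),
      inner_mulCoord, map_mul, Complex.conj_I, Complex.conj_ofReal, hX, hY, hM0, hM1]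
    ring
  rw [key]
  have hXX : (inner ℂ X X).re = ‖X‖ ^ 2 := by
    rw [inner_self_eq_norm_sq_to_K]; norm_cast
  have hYY : (inner ℂ Y Y).re = ‖Y‖ ^ 2 := by
    rw [inner_self_eq_norm_sq_to_K]; norm_cast
  have hc : -(|ω| * (‖Y‖ * ‖M0‖ + ‖X‖ * ‖M1‖))
      ≤ ((-(Complex.I * ω)) * (inner ℂ Y M0 - inner ℂ X M1)).re := by
    refine (neg_le_neg ?_).trans (neg_le_of_abs_le (Complex.abs_re_le_norm _))
    rw [norm_mul, norm_neg, norm_mul, Complex.norm_I, one_mul, Complex.norm_real,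
      Real.norm_eq_abs]
    refine mul_le_mul_of_nonneg_left ((norm_sub_le _ _).trans ?_) (abs_nonneg _)
    exact add_le_add (norm_inner_le_norm _ _) (norm_inner_le_norm _ _)
  rw [Complex.add_re, Complex.add_re, hXX, hYY]
  have hd : |ω| * (‖Y‖ * ‖M0‖ + ‖X‖ * ‖M1‖)
      ≤ |ω| * (‖Y‖ * (R * ‖F‖) + ‖X‖ * (R * ‖F‖)) := by gcongr
  have hw : |ω| ^ 2 = ω ^ 2 := sq_abs ω
  have : 0 ≤ (‖X‖ - |ω| * R * ‖F‖ / 2) ^ 2 + (‖Y‖ - |ω| * R * ‖F‖ / 2) ^ 2 := by positivity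
  have h5 : 0 ≤ |ω| ^ 2 * R ^ 2 * ‖F‖ ^ 2 := by positivity
  rw [← hw]
  nlinarith

/-- The Hamiltonian `H_ω(x₀, y₀) = -Δ_D + i ω ((x - x₀) ∂ᵧ - (y - y₀) ∂ₓ)` of the bounded region
`Ω` with the Dirichlet condition, rotating with angular velocity `ω` around `c = (x₀, y₀)`: the
Friedrichs extension of the differential expression on `C₀^∞(Ω)`. -/
def hamiltonian (Ω : Opens Plane) (hb : Bornology.IsBounded (Ω : Set Plane)) (ω : ℝ)
    (c : Plane) : L2 Ω →ₗ.[ℂ] L2 Ω :=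
  friedrichs (minimalHamiltonian Ω ω c) (minimalHamiltonian_semibounded Ω hb ω c)

/-- The set of real eigenvalues of `H_ω(x₀, y₀)`. -/
def eigenvalues (Ω : Opens Plane) (hb : Bornology.IsBounded (Ω : Set Plane)) (ω : ℝ)
    (c : Plane) : Set ℝ :=
  {μ : ℝ | IsEigenvalue (hamiltonian Ω hb ω c) (μ : ℂ)}

/-- The ground state eigenvalue `λ₁^ω(x₀, y₀)`: the lowest eigenvalue of `H_ω(x₀, y₀)`. -/
def groundStateEigenvalue (Ω : Opens Plane) (hb : Bornology.IsBounded (Ω : Set Plane)) (ω : ℝ)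
    (c : Plane) : ℝ :=
  sInf (eigenvalues Ω hb ω c)

end RotatingFrame

end

/-! The lowest eigenvalue equals the infimum of the quadratic form over unit vectors (`bottom`, here
`rotBottom`). It is attained because a bound on the form controls the gradient, and on a bounded
region Rellich's theorem then makes minimising sequences precompact (`totallyBounded_testFunctions`,
`isLeast_bottom`).

Completing the square writes the form as a magnetic kinetic energy minus the centrifugal term `ω² /
4 * |p - c|²` (`rotForm_eq`). Moving the centre by `d` changes the vector potential by a constant,
which a linear phase removes, so only the centrifugal term changes: for a unit vector `φ` the form
gains `ω² / 4 * (2 d · m - |d|²)`, where `m` is the mean of `p - c` for the density `|φ|²`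
(`rotForm_add_gauge`). Since `m` is bounded, this gives continuity of the bottom in the centre and
an upper bound decaying like `-|d|²`, hence a maximum.

If `c` is not in the convex open set, a line through `c` leaves it strictly on one side. For a
normal `v` pointing to that side, `v · m` is positive. It is even bounded below uniformly over `φ`
of bounded energy: such `φ` vanishes beyond the line, and a gradient bound keeps its mass from
collecting in a thin strip along it (`linear_moment_lower_bound`). For small `t` the linear gain of
the shift `t v` beats the quadratic loss, while states of high energy do not affect the infimum. So
the bottom increases strictly (`exists_rotBottom_lt`), and `c` is not a maximum point. This covers
boundary points too, since the separation is strict on the open set. -/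

namespace RotatingFrame

/-! ### The bottom of the form as the lowest eigenvalue of the Friedrichs extension -/

section AbstractSpectral

variable {H : Type*} [NormedAddCommGroup H] [InnerProductSpace ℂ H]

/-- The infimum of the quadratic form of `T` over the unit vectors in its domain. -/
noncomputable def bottom (T : H →ₗ.[ℂ] H) : ℝ :=
  sInf {r : ℝ | ∃ u : T.domain, ‖(u : H)‖ = 1 ∧ quadForm T u = r}

theorem bddBelow_quadForm {T : H →ₗ.[ℂ] H} (hT : IsSemibounded T) :
    BddBelow {r : ℝ | ∃ u : T.domain, ‖(u : H)‖ = 1 ∧ quadForm T u = r} := by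
  obtain ⟨m, hm⟩ := hT.bound
  refine ⟨-m, ?_⟩
  rintro _ ⟨u, hu, rfl⟩
  simpa [hu, quadForm] using hm u

theorem exists_unit_smul {T : H →ₗ.[ℂ] H} {u : T.domain} (hu : (u : H) ≠ 0) :
    ∃ w : T.domain, ‖(w : H)‖ = 1 ∧ quadForm T u = quadForm T w * ‖(u : H)‖ ^ 2 := by
  have hn : ‖(u : H)‖ ≠ 0 := norm_ne_zero_iff.2 hu
  refine ⟨((‖(u : H)‖⁻¹ : ℝ) : ℂ) • u, ?_, ?_⟩
  · rw [Submodule.coe_smul, norm_smul, Complex.norm_real, norm_inv, norm_norm,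
      inv_mul_cancel₀ hn]
  · rw [quadForm_smul, Complex.norm_real, norm_inv, norm_norm]
    field_simp

theorem bottom_mul_le {T : H →ₗ.[ℂ] H} (hT : IsSemibounded T) (u : T.domain) :
    bottom T * ‖(u : H)‖ ^ 2 ≤ quadForm T u := by
  by_cases hu : (u : H) = 0
  · have : u = 0 := Subtype.ext hu
    simp [this, quadForm]
  · obtain ⟨w, hw, h⟩ := exists_unit_smul hu
    rw [h]
    exact mul_le_mul_of_nonneg_right (csInf_le (bddBelow_quadForm hT) ⟨w, hw, rfl⟩)
      (sq_nonneg _)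

theorem le_bottom {T : H →ₗ.[ℂ] H} (hne : ∃ u : T.domain, (u : H) ≠ 0) {r : ℝ}
    (h : ∀ u : T.domain, ‖(u : H)‖ = 1 → r ≤ quadForm T u) : r ≤ bottom T := by
  obtain ⟨u, hu⟩ := hne
  obtain ⟨w, hw, -⟩ := exists_unit_smul hu
  -- Without a nonzero vector the set of values would be empty and `sInf` would take its default
  -- value 0.
  refine le_csInf ⟨_, w, hw, rfl⟩ ?_
  rintro _ ⟨v, hv, rfl⟩
  exact h v hv

theorem exists_quadForm_lt {T : H →ₗ.[ℂ] H} (hne : ∃ u : T.domain, (u : H) ≠ 0) {r : ℝ}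
    (h : bottom T < r) : ∃ u : T.domain, ‖(u : H)‖ = 1 ∧ quadForm T u < r := by
  by_contra! hc
  exact absurd (le_bottom hne hc) (not_le.2 h)

/-- The sesquilinear form `⟪T x, y⟫ - r ⟪x, y⟫`. -/
noncomputable def shiftedForm (T : H →ₗ.[ℂ] H) (r : ℝ) (x y : T.domain) : ℂ :=
  inner ℂ (T x) (y : H) - r * inner ℂ (x : H) (y : H)

theorem re_shiftedForm_self (T : H →ₗ.[ℂ] H) (r : ℝ) (x : T.domain) :
    (shiftedForm T r x x).re = quadForm T x - r * ‖(x : H)‖ ^ 2 := by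
  have : inner ℂ (x : H) (x : H) = ((‖(x : H)‖ ^ 2 : ℝ) : ℂ) := by
    rw [inner_self_eq_norm_sq_to_K]; norm_cast
  rw [shiftedForm, this, Complex.sub_re, Complex.re_ofReal_mul, Complex.ofReal_re, quadForm]

theorem shiftedForm_eq_right {T : H →ₗ.[ℂ] H} (hT : IsSemibounded T) (r : ℝ)
    (x y : T.domain) :
    shiftedForm T r x y = inner ℂ (x : H) (T y) - r * inner ℂ (x : H) (y : H) := by
  rw [shiftedForm, hT.symm x y]

/-- The Cauchy–Schwarz inequality for a nonnegative shifted form. -/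
theorem norm_shiftedForm_sq_le {T : H →ₗ.[ℂ] H} (hT : IsSemibounded T) {r : ℝ}
    (hr : r ≤ bottom T) (x y : T.domain) :
    ‖shiftedForm T r x y‖ ^ 2
      ≤ (shiftedForm T r x x).re * (shiftedForm T r y y).re := by
  have hconj : ∀ x y : T.domain,
      (starRingEnd ℂ) (shiftedForm T r y x) = shiftedForm T r x y := by
    intro x y
    rw [shiftedForm_eq_right hT, shiftedForm, map_sub, map_mul, inner_conj_symm,
      inner_conj_symm, Complex.conj_ofReal]
  -- For `r ≤ bottom T` the shifted form is positive semidefinite, so the general Cauchy–Schwarz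
  -- inequality for pre-inner products applies.
  let core : PreInnerProductSpace.Core ℂ T.domain :=
    { inner := fun x y => shiftedForm T r x y
      conj_inner_symm := hconj
      re_inner_nonneg := fun x => by
        change 0 ≤ (shiftedForm T r x x).re
        rw [re_shiftedForm_self]
        have := bottom_mul_le hT x
        have h2 := mul_le_mul_of_nonneg_right hr (sq_nonneg ‖(x : H)‖)
        linarith
      add_left := fun x y z => by
        simp only [shiftedForm, LinearPMap.map_add, Submodule.coe_add, inner_add_left]
        ring
      smul_left := fun x y z => by
        simp only [shiftedForm, LinearPMap.map_smul, Submodule.coe_smul, inner_smul_left]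
        ring }
  have h := @InnerProductSpace.Core.inner_mul_inner_self_le ℂ T.domain _ _ _ core x y
  have h' : ‖shiftedForm T r x y‖ * ‖shiftedForm T r y x‖
      ≤ (shiftedForm T r x x).re * (shiftedForm T r y y).re := h
  rwa [← hconj y x, RCLike.norm_conj, ← sq] at h'

/-- Every real eigenvalue of the Friedrichs extension lies above the bottom of the form. -/
theorem bottom_le_of_isEigenvalue [CompleteSpace H] {T : H →ₗ.[ℂ] H} (hT : IsSemibounded T)
    (hd : Dense (T.domain : Set H)) {μ : ℝ} (hμ : IsEigenvalue (friedrichs T hT) (μ : ℂ)) :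
    bottom T ≤ μ := by
  obtain ⟨⟨u, hu1, hu2⟩, hu0, hu⟩ := hμ
  change u ≠ 0 at hu0
  obtain ⟨s, hs, hsq⟩ : IsFormLimit T u := hu1
  have hadj : ∀ v : T.domain, (μ : ℂ) * inner ℂ u (v : H) = inner ℂ u (T v) := by
    intro v
    have h1 := LinearPMap.adjoint_isFormalAdjoint hd ⟨u, hu2⟩ v
    have h2 : T† ⟨u, hu2⟩ = (μ : ℂ) • u := hu
    rw [h2, inner_smul_left, Complex.conj_ofReal] at h1
    exact h1
  set r := bottom T with hr
  have hpos : ∀ x : T.domain, 0 ≤ (shiftedForm T r x x).re := fun x => by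
    rw [re_shiftedForm_self]
    linarith [bottom_mul_le hT x]
  have h1 : Tendsto (fun p : ℕ × ℕ => p.1) atTop atTop := by
    rw [← prod_atTop_atTop_eq]; exact tendsto_fst
  have h2 : Tendsto (fun p : ℕ × ℕ => p.2) atTop atTop := by
    rw [← prod_atTop_atTop_eq]; exact tendsto_snd
  have hdiff : Tendsto (fun p : ℕ × ℕ => (shiftedForm T r (s p.1 - s p.2) (s p.1 - s p.2)).re)
      atTop (𝓝 0) := by
    simp only [re_shiftedForm_self, Submodule.coe_sub]
    have h3 : Tendsto (fun p : ℕ × ℕ => ((s p.1 : H) - s p.2)) atTop (𝓝 0) := by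
      simpa using (hs.comp h1).sub (hs.comp h2)
    simpa using hsq.sub ((h3.norm.pow 2).const_mul r)
  -- With `x = s m` and `y = s n` the error term is small, since the sequence is Cauchy for the
  -- form, and the mixed term has a limit in `m`, since the operator can be moved onto the fixed
  -- vector `s n`.
  have hdev : ∀ x y : T.domain, (shiftedForm T r y y).re
      ≤ (shiftedForm T r x y).re
        + √((shiftedForm T r (x - y) (x - y)).re * (shiftedForm T r y y).re) := by
    intro x y
    have h3 : shiftedForm T r x y = shiftedForm T r (x - y) y + shiftedForm T r y y := by
      simp only [shiftedForm, LinearPMap.map_sub, Submodule.coe_sub, inner_sub_left]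
      ring
    have h4 := Real.le_sqrt_of_sq_le (norm_shiftedForm_sq_le hT hr.le (x - y) y)
    have h5 := (abs_le.1 ((Complex.abs_re_le_norm (shiftedForm T r (x - y) y)).trans h4)).1
    rw [h3, Complex.add_re]
    linarith
  have hlim : ∀ n, Tendsto (fun m => (shiftedForm T r (s m) (s n)).re) atTop
      (𝓝 ((μ - r) * (inner ℂ u (s n : H)).re)) := by
    intro n
    have h3 : Tendsto (fun m => inner ℂ (s m : H) (T (s n)) - r * inner ℂ (s m : H) (s n : H))
        atTop (𝓝 (inner ℂ u (T (s n)) - r * inner ℂ u (s n : H))) :=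
      (hs.inner tendsto_const_nhds).sub ((hs.inner tendsto_const_nhds).const_mul _)
    rw [← hadj] at h3
    have h4 := (Complex.continuous_re.tendsto _).comp h3
    simp only [Function.comp_def, ← shiftedForm_eq_right hT] at h4
    rwa [← sub_mul, ← Complex.ofReal_sub, Complex.re_ofReal_mul] at h4
  have hlim2 : Tendsto (fun n => (μ - r) * (inner ℂ u (s n : H)).re) atTop
      (𝓝 ((μ - r) * ‖u‖ ^ 2)) := by
    have h3 := (Complex.continuous_re.tendsto _).comp
      ((tendsto_const_nhds (x := u)).inner hs)
    have h4 : (inner ℂ u u).re = ‖u‖ ^ 2 := by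
      rw [inner_self_eq_norm_sq_to_K]; norm_cast
    rw [h4] at h3
    exact h3.const_mul _
  -- the form is bounded along the sequence
  obtain ⟨N, hN⟩ : ∃ N, ∀ n m, N ≤ n → N ≤ m →
      (shiftedForm T r (s n - s m) (s n - s m)).re ≤ 1 := by
    have := hdiff.eventually (eventually_le_nhds (zero_lt_one))
    obtain ⟨⟨a, b⟩, hab⟩ := eventually_atTop.1 this
    exact ⟨max a b, fun n m hn hm => hab (n, m) ⟨(le_max_left _ _).trans hn,
      (le_max_right _ _).trans hm⟩⟩
  obtain ⟨M, hM0, hM⟩ : ∃ M : ℝ, 0 < M ∧ ∀ n, N ≤ n → (shiftedForm T r (s n) (s n)).re ≤ M := by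
    -- Parallelogram law for the seminorm of the shifted form, applied to `s n = (s n - s N) + s N`.
    refine ⟨2 + 2 * (shiftedForm T r (s N) (s N)).re, by linarith [hpos (s N)], fun n hn => ?_⟩
    have h3 := quadForm_parallelogram T (s n - s N) (s N)
    have h4 := parallelogram_law_with_norm ℂ (((s n - s N : T.domain)) : H) (s N : H)
    have h5 := hN n N hn le_rfl
    have h6 := hpos (s n - s N - s N)
    rw [sub_add_cancel] at h3
    rw [← Submodule.coe_add, sub_add_cancel, ← Submodule.coe_sub] at h4
    rw [re_shiftedForm_self] at h5 h6 ⊢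
    rw [re_shiftedForm_self]
    have h7 := congrArg (r * ·) h4
    nlinarith
  by_contra! hlt
  have hu' : 0 < ‖u‖ ^ 2 := by have := norm_pos_iff.2 hu0; positivity
  have hneg : (μ - r) * ‖u‖ ^ 2 < 0 := mul_neg_of_neg_of_pos (by linarith) hu'
  set δ := -((μ - r) * ‖u‖ ^ 2) with hδ
  have hδ0 : 0 < δ := by linarith
  -- The nonnegativity of the form at `s n` nearly passes to the mixed term, up to `δ / 2`. Its
  -- limit would be `-δ` if `μ < r`, a contradiction.
  have hge : ∀ᶠ n in atTop, -(δ / 2) ≤ (μ - r) * (inner ℂ u (s n : H)).re := by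
    have h3 := hdiff.eventually (eventually_le_nhds (show (0 : ℝ) < (δ / 2) ^ 2 / M by positivity))
    obtain ⟨⟨a, b⟩, hab⟩ := eventually_atTop.1 h3
    filter_upwards [eventually_ge_atTop (max (max a b) N)] with n hn
    refine ge_of_tendsto (hlim n) ?_
    filter_upwards [eventually_ge_atTop (max (max a b) N)] with m hm
    have h4 := hab (m, n) ⟨(le_max_left _ _).trans ((le_max_left _ _).trans hm),
      (le_max_right _ _).trans ((le_max_left _ _).trans hn)⟩
    have h5 := hM n ((le_max_right _ _).trans hn)
    have h6 := hdev (s m) (s n)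
    have h7 : √((shiftedForm T r (s m - s n) (s m - s n)).re * (shiftedForm T r (s n) (s n)).re)
        ≤ δ / 2 := by
      refine Real.sqrt_le_iff.2 ⟨by positivity, ?_⟩
      refine (mul_le_mul h4 h5 (hpos _) (by positivity)).trans_eq ?_
      field_simp
    linarith [hpos (s n)]
  have := ge_of_tendsto hlim2 hge
  linarith

/-- If the form-bounded sequences of unit vectors have convergent subsequences, the bottom of the
form is an eigenvalue of the Friedrichs extension. -/
theorem isEigenvalue_bottom [CompleteSpace H] {T : H →ₗ.[ℂ] H} (hT : IsSemibounded T)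
    (hd : Dense (T.domain : Set H)) (hne : ∃ u : T.domain, (u : H) ≠ 0)
    (hcomp : ∀ (C : ℝ) (s : ℕ → T.domain), (∀ n, ‖(s n : H)‖ = 1) →
      (∀ n, quadForm T (s n) ≤ C) →
      ∃ (u : H) (k : ℕ → ℕ), StrictMono k ∧ Tendsto (fun n => (s (k n) : H)) atTop (𝓝 u)) :
    IsEigenvalue (friedrichs T hT) (bottom T : ℂ) := by
  set r := bottom T with hr
  have hex : ∀ n : ℕ, ∃ u : T.domain, ‖(u : H)‖ = 1 ∧ quadForm T u < r + 1 / ((n : ℝ) + 1) :=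
    fun n => exists_quadForm_lt hne (by have := Nat.one_div_pos_of_nat (α := ℝ) (n := n); linarith)
  choose s0 hs01 hs02 using hex
  obtain ⟨u, k, hk, hu⟩ := hcomp (r + 1) s0 hs01 fun n => (hs02 n).le.trans (by
    have := Nat.one_div_le_one_div (α := ℝ) (Nat.zero_le n)
    simp at this ⊢
    exact this)
  set s := fun n => s0 (k n) with hs
  have hs1 : ∀ n, ‖(s n : H)‖ = 1 := fun n => hs01 _
  have hq : Tendsto (fun n => quadForm T (s n)) atTop (𝓝 r) := by
    have h1 : Tendsto (fun n : ℕ => r + 1 / ((n : ℝ) + 1)) atTop (𝓝 r) := by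
      simpa using tendsto_one_div_add_atTop_nhds_zero_nat.const_add r
    refine tendsto_of_tendsto_of_tendsto_of_le_of_le tendsto_const_nhds
      (h1.comp hk.tendsto_atTop) (fun n => ?_) (fun n => (hs02 (k n)).le)
    have := bottom_mul_le hT (s n)
    rwa [hs1, one_pow, mul_one] at this
  have hun : ‖u‖ = 1 := by
    refine tendsto_nhds_unique hu.norm ?_
    simp [hs01]
  have h1 : Tendsto (fun p : ℕ × ℕ => p.1) atTop atTop := by
    rw [← prod_atTop_atTop_eq]; exact tendsto_fst
  have h2 : Tendsto (fun p : ℕ × ℕ => p.2) atTop atTop := by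
    rw [← prod_atTop_atTop_eq]; exact tendsto_snd
  have hform : IsFormLimit T u := by
    refine ⟨s, hu, ?_⟩
    have hlow : Tendsto (fun p : ℕ × ℕ => r * ‖(s p.1 : H) - s p.2‖ ^ 2) atTop (𝓝 0) := by
      simpa using (((((hu.comp h1).sub (hu.comp h2)).norm).pow 2).const_mul r)
    -- The parallelogram law together with the lower bound at `s p.1 + s p.2`: a norm-convergent
    -- minimising sequence is Cauchy for the form, as `2 r + 2 r - r ‖2 u‖² = 0`.
    have hupp : Tendsto (fun p : ℕ × ℕ => 2 * quadForm T (s p.1) + 2 * quadForm T (s p.2)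
        - r * ‖(s p.1 : H) + s p.2‖ ^ 2) atTop (𝓝 0) := by
      have h3 := (((hq.comp h1).const_mul 2).add ((hq.comp h2).const_mul 2)).sub
        (((((hu.comp h1).add (hu.comp h2)).norm).pow 2).const_mul r)
      have h4 : 2 * r + 2 * r - r * ‖u + u‖ ^ 2 = 0 := by
        rw [← two_smul ℂ u, norm_smul, hun]
        norm_num
        ring
      rwa [h4] at h3
    refine tendsto_of_tendsto_of_tendsto_of_le_of_le hlow hupp (fun p => ?_) (fun p => ?_)
    · simpa using bottom_mul_le hT (s p.1 - s p.2)
    · have h3 := quadForm_parallelogram T (s p.1) (s p.2)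
      have h4 := bottom_mul_le hT (s p.1 + s p.2)
      rw [Submodule.coe_add] at h4
      simp only
      linarith
  -- The weak Euler–Lagrange equation, from Cauchy–Schwarz: the shifted form at `s n` tends to 0,
  -- hence so does its pairing with any fixed `v`.
  have hweak : ∀ v : T.domain, inner ℂ u (T v) = r * inner ℂ u (v : H) := by
    intro v
    have h3 : Tendsto (fun n => inner ℂ (s n : H) (T v) - r * inner ℂ (s n : H) (v : H))
        atTop (𝓝 (inner ℂ u (T v) - r * inner ℂ u (v : H))) :=
      (hu.inner tendsto_const_nhds).sub ((hu.inner tendsto_const_nhds).const_mul _)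
    have h4 : Tendsto (fun n => ‖shiftedForm T r (s n) v‖ ^ 2) atTop (𝓝 0) := by
      have h5 : Tendsto (fun n => (shiftedForm T r (s n) (s n)).re * (shiftedForm T r v v).re)
          atTop (𝓝 0) := by
        simp only [re_shiftedForm_self T r (s _), hs1]
        simpa using (hq.sub_const r).mul_const (shiftedForm T r v v).re
      exact squeeze_zero (fun n => sq_nonneg _) (fun n => norm_shiftedForm_sq_le hT hr.le _ _) h5
    have h5 : Tendsto (fun n => ‖shiftedForm T r (s n) v‖) atTop (𝓝 0) := by
      simpa using h4.sqrt
    have h6 := tendsto_zero_iff_norm_tendsto_zero.2 h5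
    simp only [shiftedForm_eq_right hT] at h6
    exact sub_eq_zero.1 (tendsto_nhds_unique h3 h6)
  have hmem : u ∈ T†.domain := by
    refine LinearPMap.mem_adjoint_domain_of_exists u ⟨(r : ℂ) • u, fun v => ?_⟩
    rw [hweak, inner_smul_left, Complex.conj_ofReal]
  refine ⟨⟨u, hform, hmem⟩, ?_, ?_⟩
  · intro h0
    change u = 0 at h0
    simp [h0] at hun
  · change T† ⟨u, hmem⟩ = (r : ℂ) • u
    refine LinearPMap.adjoint_apply_eq hd _ fun v => ?_
    rw [hweak, inner_smul_left, Complex.conj_ofReal]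

theorem isLeast_bottom [CompleteSpace H] {T : H →ₗ.[ℂ] H} (hT : IsSemibounded T)
    (hd : Dense (T.domain : Set H)) (hne : ∃ u : T.domain, (u : H) ≠ 0)
    (hcomp : ∀ (C : ℝ) (s : ℕ → T.domain), (∀ n, ‖(s n : H)‖ = 1) →
      (∀ n, quadForm T (s n) ≤ C) →
      ∃ (u : H) (k : ℕ → ℕ), StrictMono k ∧ Tendsto (fun n => (s (k n) : H)) atTop (𝓝 u)) :
    IsLeast {μ : ℝ | IsEigenvalue (friedrichs T hT) (μ : ℂ)} (bottom T) :=
  ⟨isEigenvalue_bottom hT hd hne hcomp, fun _ hμ => bottom_le_of_isEigenvalue hT hd hμ⟩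

end AbstractSpectral

/-! ### Rellich compactness by averaging over grid cells -/

/-- Jensen's inequality for the square of the norm of an integral. -/
theorem enorm_integral_sq_le {α : Type*} [MeasurableSpace α] (μ : Measure α) {f : α → ℂ}
    (hf : AEStronglyMeasurable f μ) :
    ‖∫ a, f a ∂μ‖ₑ ^ 2 ≤ μ Set.univ * ∫⁻ a, ‖f a‖ₑ ^ 2 ∂μ := by
  have h1 : ∫⁻ a, ‖f a‖ₑ * 1 ∂μ
      ≤ (∫⁻ a, ‖f a‖ₑ ^ (2 : ℝ) ∂μ) ^ (1 / (2 : ℝ)) * (∫⁻ _, 1 ^ (2 : ℝ) ∂μ) ^ (1 / (2 : ℝ)) :=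
    ENNReal.lintegral_mul_le_Lp_mul_Lq μ Real.HolderConjugate.two_two hf.enorm aemeasurable_const
  simp only [mul_one, one_pow, lintegral_one, ENNReal.rpow_two] at h1
  calc ‖∫ a, f a ∂μ‖ₑ ^ 2 ≤ (∫⁻ a, ‖f a‖ₑ ∂μ) ^ 2 := by
        gcongr; exact enorm_integral_le_lintegral_enorm f
    _ ≤ ((∫⁻ a, ‖f a‖ₑ ^ 2 ∂μ) ^ (1 / (2 : ℝ)) * μ Set.univ ^ (1 / (2 : ℝ))) ^ 2 := by gcongr
    _ = μ Set.univ * ∫⁻ a, ‖f a‖ₑ ^ 2 ∂μ := by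
        rw [mul_pow, ← ENNReal.rpow_two, ← ENNReal.rpow_two, ← ENNReal.rpow_mul,
          ← ENNReal.rpow_mul]
        norm_num
        rw [mul_comm]

/-- Test functions vanish off `Ω`, so the norm can be computed on the whole plane, where
translations preserve the measure. -/
theorem enorm_toL2_sq (Ω : Opens Plane) (φ : 𝓓(Ω, ℂ)) :
    ‖toL2 Ω φ‖ₑ ^ 2 = ∫⁻ p, ‖φ p‖ₑ ^ 2 := by
  have h : ‖toL2 Ω φ‖ₑ ^ 2 = ∫⁻ p in (Ω : Set Plane), ‖φ p‖ₑ ^ 2 := by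
    change ‖(memLp_testFunction Ω φ).toLp φ‖ₑ ^ 2 = _
    rw [Lp.enorm_toLp]
    have := eLpNorm_nnreal_pow_eq_lintegral (f := φ) (p := 2)
      (μ := volume.restrict (Ω : Set Plane)) (by norm_num)
    simpa using this
  rw [h, ← lintegral_indicator Ω.isOpen.measurableSet]
  refine lintegral_congr fun p => ?_
  by_cases hp : p ∈ (Ω : Set Plane)
  · rw [Set.indicator_of_mem hp]
  · rw [Set.indicator_of_notMem hp, eq_zero_of_notMem Ω φ hp]
    simp

/-- The translation estimate: the difference quotient is bounded by the derivative in `L²`. -/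
theorem lintegral_translate_sub_le (Ω : Opens Plane) (φ : 𝓓(Ω, ℂ)) (h : Plane) :
    ∫⁻ p, ‖φ (p + h) - φ p‖ₑ ^ 2 ≤ ‖toL2 Ω (partialDeriv Ω h φ)‖ₑ ^ 2 := by
  set ψ := partialDeriv Ω h φ with hψ
  have hψc : Continuous ψ := ψ.continuous
  have hpt : ∀ p, ‖φ (p + h) - φ p‖ₑ ^ 2
      ≤ ∫⁻ t in Set.Ioc (0 : ℝ) 1, ‖ψ (p + t • h)‖ₑ ^ 2 := by
    intro p
    have hd : ∀ t : ℝ, HasDerivAt (fun t : ℝ => φ (p + t • h)) (ψ (p + t • h)) t := by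
      intro t
      have h1 := hasLineDerivAt_testFunction Ω h φ (p + t • h)
      -- A line derivative lives at parameter 0; writing 0 as `t - t` lets `comp_sub_const` carry it
      -- to `t`.
      have h2 : HasDerivAt (fun s : ℝ => φ (p + t • h + s • h)) (ψ (p + t • h)) (t - t) := by
        rw [sub_self]; exact h1
      have h3 := h2.comp_sub_const t t
      refine h3.congr_of_eventuallyEq (Eventually.of_forall fun s => ?_)
      simp only
      congr 1
      rw [add_assoc, ← add_smul]
      congr 2
      ring
    have hc : Continuous fun t : ℝ => ψ (p + t • h) := by fun_prop
    have h1 := intervalIntegral.integral_eq_sub_of_hasDerivAt (a := 0) (b := 1)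
      (fun t _ => hd t) (hc.intervalIntegrable 0 1)
    rw [one_smul, zero_smul, add_zero, intervalIntegral.integral_of_le zero_le_one] at h1
    rw [← h1]
    refine (enorm_integral_sq_le _ hc.aestronglyMeasurable).trans_eq ?_
    simp
  refine (lintegral_mono hpt).trans ?_
  rw [lintegral_lintegral_swap]
  · have h1 : ∀ t : ℝ, ∫⁻ p, ‖ψ (p + t • h)‖ₑ ^ 2 = ‖toL2 Ω ψ‖ₑ ^ 2 := fun t => by
      rw [enorm_toL2_sq]
      exact lintegral_add_right_eq_self (fun p => ‖ψ p‖ₑ ^ 2) (t • h)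
    simp only [h1]
    simp
  · refine Continuous.aemeasurable ?_
    have : Continuous fun q : Plane × ℝ => ψ (q.1 + q.2 • h) := by fun_prop
    exact (ENNReal.continuous_pow 2).comp (continuous_enorm.comp this)

theorem partialDeriv_eq_fderiv (Ω : Opens Plane) (v : Plane) (φ : 𝓓(Ω, ℂ)) (p : Plane) :
    partialDeriv Ω v φ p = fderiv ℝ φ p v := by
  rw [partialDeriv_apply]
  exact ((φ.contDiff.differentiable (by simp)).differentiableAt).lineDeriv_eq_fderiv

theorem partialDeriv_eq (Ω : Opens Plane) (h : Plane) (φ : 𝓓(Ω, ℂ)) :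
    partialDeriv Ω h φ
      = ((h 0 : ℝ) : ℂ) • partialDeriv Ω ex φ + ((h 1 : ℝ) : ℂ) • partialDeriv Ω ey φ := by
  ext p
  change _ = ((h 0 : ℝ) : ℂ) • partialDeriv Ω ex φ p + ((h 1 : ℝ) : ℂ) • partialDeriv Ω ey φ p
  simp only [partialDeriv_eq_fderiv]
  have : h = h 0 • ex + h 1 • ey := by
    ext i
    fin_cases i <;> simp
  conv_lhs => rw [this]
  rw [map_add, map_smul, map_smul]
  simp

theorem norm_partialDeriv_sq_le (Ω : Opens Plane) (h : Plane) (φ : 𝓓(Ω, ℂ)) :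
    ‖toL2 Ω (partialDeriv Ω h φ)‖ ^ 2 ≤ ‖h‖ ^ 2 *
      (‖toL2 Ω (partialDeriv Ω ex φ)‖ ^ 2 + ‖toL2 Ω (partialDeriv Ω ey φ)‖ ^ 2) := by
  set X := toL2 Ω (partialDeriv Ω ex φ)
  set Y := toL2 Ω (partialDeriv Ω ey φ)
  have h1 : ‖toL2 Ω (partialDeriv Ω h φ)‖ ≤ |h 0| * ‖X‖ + |h 1| * ‖Y‖ := by
    rw [partialDeriv_eq, map_add, map_smul, map_smul]
    refine (norm_add_le _ _).trans_eq ?_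
    rw [norm_smul, norm_smul, Complex.norm_real, Complex.norm_real, Real.norm_eq_abs,
      Real.norm_eq_abs]
  have h2 : ‖h‖ ^ 2 = |h 0| ^ 2 + |h 1| ^ 2 := by
    rw [EuclideanSpace.norm_sq_eq, Fin.sum_univ_two, Real.norm_eq_abs, Real.norm_eq_abs]
  rw [h2]
  refine (pow_le_pow_left₀ (norm_nonneg _) h1 2).trans ?_
  nlinarith [sq_nonneg (|h 0| * ‖Y‖ - |h 1| * ‖X‖)]

theorem lintegral_translate_sub_le' (Ω : Opens Plane) (φ : 𝓓(Ω, ℂ)) (h : Plane) {C : ℝ}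
    (hC : ‖toL2 Ω (partialDeriv Ω ex φ)‖ ^ 2 + ‖toL2 Ω (partialDeriv Ω ey φ)‖ ^ 2 ≤ C) :
    ∫⁻ p, ‖φ (p + h) - φ p‖ₑ ^ 2 ≤ ENNReal.ofReal (‖h‖ ^ 2 * C) := by
  refine (lintegral_translate_sub_le Ω φ h).trans ?_
  rw [← ofReal_norm, ← ENNReal.ofReal_pow (norm_nonneg _)]
  exact ENNReal.ofReal_le_ofReal ((norm_partialDeriv_sq_le Ω h φ).trans (by gcongr))

/-- A bounded set that is approximated to any precision by finite-dimensional subspaces is totally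
bounded. -/
theorem totallyBounded_of_finiteDimensional_approx {E : Type*} [NormedAddCommGroup E]
    [NormedSpace ℂ E] {S : Set E} {R : ℝ} (hS : ∀ u ∈ S, ‖u‖ ≤ R)
    (h : ∀ ε > 0, ∃ F : Submodule ℂ E, FiniteDimensional ℂ F ∧ ∀ u ∈ S, ∃ g ∈ F, ‖u - g‖ ≤ ε) :
    TotallyBounded S := by
  rw [Metric.totallyBounded_iff]
  intro ε hε
  obtain ⟨F, hF, hFS⟩ := h (ε / 2) (by positivity)
  have : ProperSpace F := FiniteDimensional.proper ℂ F
  -- Every approximant within `ε / 2` of a point of `S` has norm at most `R + ε / 2`.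
  have hK : IsCompact ((↑) '' Metric.closedBall (0 : F) (R + ε / 2) : Set E) :=
    (isCompact_closedBall (0 : F) (R + ε / 2)).image continuous_subtype_val
  obtain ⟨t, ht, hcov⟩ := Metric.totallyBounded_iff.1 hK.totallyBounded (ε / 2) (by positivity)
  refine ⟨t, ht, fun u hu => ?_⟩
  obtain ⟨g, hg, hug⟩ := hFS u hu
  have hgK : g ∈ ((↑) '' Metric.closedBall (0 : F) (R + ε / 2) : Set E) := by
    refine ⟨⟨g, hg⟩, ?_, rfl⟩
    rw [mem_closedBall_zero_iff]
    change ‖g‖ ≤ _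
    have := norm_sub_norm_le g u
    rw [norm_sub_rev] at this
    linarith [hS u hu]
  obtain ⟨y, hy, hgy⟩ := Set.mem_iUnion₂.1 (hcov hgK)
  refine Set.mem_iUnion₂.2 ⟨y, hy, ?_⟩
  rw [Metric.mem_ball] at hgy ⊢
  have := dist_triangle u g y
  rw [dist_eq_norm u g] at this
  linarith

/-- The index of the cell of the grid with mesh `δ` that contains `p`. -/
noncomputable def gridIndex (δ : ℝ) (p : Plane) : Fin 2 → ℤ := fun i => ⌊p i / δ⌋

theorem measurable_gridIndex (δ : ℝ) : Measurable (gridIndex δ) := by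
  refine measurable_pi_lambda _ fun i => Int.measurable_floor.comp ?_
  have : Continuous fun p : Plane => p i / δ := by fun_prop
  exact this.measurable

/-- The cell of the grid with mesh `δ` with index `k`. -/
def gridCell (δ : ℝ) (k : Fin 2 → ℤ) : Set Plane := gridIndex δ ⁻¹' {k}

theorem measurableSet_gridCell (δ : ℝ) (k : Fin 2 → ℤ) : MeasurableSet (gridCell δ k) :=
  measurable_gridIndex δ (measurableSet_singleton k)

theorem volume_box (s : Fin 2 → Set ℝ) :
    volume {p : Plane | ∀ i, p i ∈ s i} = volume (s 0) * volume (s 1) := by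
  have h := (EuclideanSpace.volume_preserving_symm_measurableEquiv_toLp (Fin 2)).measure_preimage_equiv
    (Set.univ.pi s)
  rw [volume_pi_pi, Fin.prod_univ_two] at h
  rw [← h]
  congr 1
  ext p
  simp

theorem volume_gridCell {δ : ℝ} (hδ : 0 < δ) (k : Fin 2 → ℤ) :
    volume (gridCell δ k) = ENNReal.ofReal (δ ^ 2) := by
  have h : gridCell δ k = {p : Plane | ∀ i, p i ∈ Set.Ico (k i * δ) (k i * δ + δ)} := by
    ext p
    simp only [gridCell, gridIndex, Set.mem_preimage, Set.mem_singleton_iff, funext_iff,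
      Int.floor_eq_iff, Set.mem_ofPred_eq, Set.mem_Ico, le_div_iff₀ hδ, div_lt_iff₀ hδ, add_mul,
      one_mul]
  rw [h, volume_box]
  simp only [Real.volume_Ico, add_sub_cancel_left]
  rw [← ENNReal.ofReal_mul hδ.le, sq]

/-- The square of side `2δ` around the origin. -/
def gridBox (δ : ℝ) : Set Plane := {h | ∀ i, h i ∈ Set.Icc (-δ) δ}

theorem measurableSet_gridBox (δ : ℝ) : MeasurableSet (gridBox δ) := by
  have : gridBox δ = ⋂ i, {h : Plane | h i ∈ Set.Icc (-δ) δ} := by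
    ext; simp [gridBox]
  rw [this]
  refine MeasurableSet.iInter fun i => ?_
  have hc : Continuous fun p : Plane => p i := by fun_prop
  exact hc.measurable measurableSet_Icc

theorem volume_gridBox {δ : ℝ} (hδ : 0 < δ) :
    volume (gridBox δ) = ENNReal.ofReal (4 * δ ^ 2) := by
  rw [gridBox, volume_box fun _ => Set.Icc (-δ) δ, Real.volume_Icc,
    ← ENNReal.ofReal_mul (by linarith)]
  congr 1
  ring

theorem norm_sq_le_of_mem_gridBox {δ : ℝ} {h : Plane} (hh : h ∈ gridBox δ) :
    ‖h‖ ^ 2 ≤ 2 * δ ^ 2 := by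
  have h0 := hh 0
  have h1 := hh 1
  rw [EuclideanSpace.norm_sq_eq, Fin.sum_univ_two, Real.norm_eq_abs, Real.norm_eq_abs, sq_abs,
    sq_abs]
  nlinarith [h0.1, h0.2, h1.1, h1.2]

theorem sub_mem_gridBox {δ : ℝ} (hδ : 0 < δ) {p q : Plane} (h : gridIndex δ p = gridIndex δ q) :
    p - q ∈ gridBox δ := by
  intro i
  have h1 := congrFun h i
  have h2 := Int.abs_sub_lt_one_of_floor_eq_floor h1
  rw [← sub_div, abs_div, abs_of_pos hδ, div_lt_one hδ] at h2
  exact abs_le.1 h2.le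

/-- The mean value of `f` on a cell of the grid. -/
noncomputable def cellMean (δ : ℝ) (f : Plane → ℂ) (k : Fin 2 → ℤ) : ℂ :=
  ∫ q, f q ∂((volume (gridCell δ k))⁻¹ • volume.restrict (gridCell δ k))

/-- Jensen for the normalised measure on the cell of `p`. That cell lies in `p + gridBox δ`; the
enlargement makes the range of `h` independent of `p`, so that the integrals can later be exchanged.
-/
theorem enorm_sub_cellMean_sq_le {δ : ℝ} (hδ : 0 < δ) {f : Plane → ℂ} (hf : Continuous f)
    (hfc : HasCompactSupport f) (p : Plane) :
    ‖f p - cellMean δ f (gridIndex δ p)‖ₑ ^ 2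
      ≤ ENNReal.ofReal ((δ ^ 2)⁻¹) * ∫⁻ h in gridBox δ, ‖f (p + h) - f p‖ₑ ^ 2 := by
  set k := gridIndex δ p with hk
  have hV : volume (gridCell δ k) = ENNReal.ofReal (δ ^ 2) := volume_gridCell hδ k
  have hV0 : volume (gridCell δ k) ≠ 0 := by rw [hV]; simp [hδ.ne']
  have hVt : volume (gridCell δ k) ≠ ⊤ := by rw [hV]; exact ENNReal.ofReal_ne_top
  set ν := (volume (gridCell δ k))⁻¹ • volume.restrict (gridCell δ k) with hν
  have hν1 : ν Set.univ = 1 := by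
    rw [hν, Measure.smul_apply, Measure.restrict_apply_univ, smul_eq_mul,
      ENNReal.inv_mul_cancel hV0 hVt]
  have : IsProbabilityMeasure ν := ⟨hν1⟩
  have hint : Integrable f ν :=
    ((hf.integrable_of_hasCompactSupport hfc).restrict).smul_measure (ENNReal.inv_ne_top.2 hV0)
  have h1 : f p - cellMean δ f k = ∫ q, (f p - f q) ∂ν := by
    rw [integral_sub (integrable_const _) hint, integral_const, probReal_univ, one_smul]
    rfl
  rw [h1]
  refine (enorm_integral_sq_le ν (by fun_prop)).trans ?_
  rw [hν1, one_mul, hν, lintegral_smul_measure, hV, smul_eq_mul,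
    ← ENNReal.ofReal_inv_of_pos (by positivity)]
  refine mul_le_mul_right ?_ _
  rw [← lintegral_indicator (measurableSet_gridCell δ k),
    ← lintegral_indicator (measurableSet_gridBox δ),
    ← lintegral_add_left_eq_self _ p]
  refine lintegral_mono fun h => ?_
  by_cases hh : p + h ∈ gridCell δ k
  · have hb : h ∈ gridBox δ := by
      have : gridIndex δ (p + h) = gridIndex δ p := hh
      simpa using sub_mem_gridBox hδ this
    rw [Set.indicator_of_mem hh, Set.indicator_of_mem hb, ← enorm_neg, neg_sub]
  · rw [Set.indicator_of_notMem hh]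
    exact zero_le

/-- Fubini and the translation estimate. The constant is `8 δ² = δ⁻² * 4 δ² * 2 δ²`: normalisation,
area of the box, and bound on `‖h‖²`. -/
theorem lintegral_sub_cellMean_le (Ω : Opens Plane) {δ : ℝ} (hδ : 0 < δ) (φ : 𝓓(Ω, ℂ)) {C : ℝ}
    (hC : ‖toL2 Ω (partialDeriv Ω ex φ)‖ ^ 2 + ‖toL2 Ω (partialDeriv Ω ey φ)‖ ^ 2 ≤ C) :
    ∫⁻ p, ‖φ p - cellMean δ φ (gridIndex δ p)‖ₑ ^ 2 ≤ ENNReal.ofReal (8 * δ ^ 2 * C) := by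
  have hC0 : 0 ≤ C := le_trans (by positivity) hC
  refine (lintegral_mono fun p =>
    enorm_sub_cellMean_sq_le hδ φ.continuous φ.hasCompactSupport p).trans ?_
  have hφ : Continuous φ := φ.continuous
  have hcont : Continuous fun q : Plane × Plane => ‖φ (q.1 + q.2) - φ q.1‖ₑ ^ 2 := by
    have : Continuous fun q : Plane × Plane => φ (q.1 + q.2) - φ q.1 := by fun_prop
    exact (ENNReal.continuous_pow 2).comp (continuous_enorm.comp this)
  rw [lintegral_const_mul' _ _ ENNReal.ofReal_ne_top,
    lintegral_lintegral_swap hcont.aemeasurable]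
  have h1 : ∫⁻ h in gridBox δ, ∫⁻ p, ‖φ (p + h) - φ p‖ₑ ^ 2
      ≤ ∫⁻ _ in gridBox δ, ENNReal.ofReal (2 * δ ^ 2 * C) := by
    refine setLIntegral_mono measurable_const fun h hh => ?_
    refine (lintegral_translate_sub_le' Ω φ h hC).trans (ENNReal.ofReal_le_ofReal ?_)
    exact mul_le_mul_of_nonneg_right (norm_sq_le_of_mem_gridBox hh) hC0
  refine (mul_le_mul_right h1 _).trans_eq ?_
  rw [lintegral_const, Measure.restrict_apply_univ, volume_gridBox hδ,
    ← ENNReal.ofReal_mul (by positivity), ← ENNReal.ofReal_mul (by positivity)]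
  congr 1
  field_simp
  ring

theorem finite_gridIndex_image {s : Set Plane} (hs : Bornology.IsBounded s) {δ : ℝ} (hδ : 0 < δ) :
    (gridIndex δ '' s).Finite := by
  obtain ⟨R, hR0, hR⟩ := hs.subset_closedBall_lt 0 0
  refine (Set.Finite.pi (t := fun _ : Fin 2 => Set.Icc ⌊-R / δ⌋ ⌊R / δ⌋)
    fun _ => Set.finite_Icc _ _).subset ?_
  rintro _ ⟨p, hp, rfl⟩ i -
  have h1 : |p i| ≤ R := (PiLp.norm_apply_le p i).trans (mem_closedBall_zero_iff.1 (hR hp))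
  obtain ⟨h2, h3⟩ := abs_le.1 h1
  exact ⟨Int.floor_mono (by gcongr), Int.floor_mono (by gcongr)⟩

theorem memLp_step {Ω : Opens Plane} (hb : Bornology.IsBounded (Ω : Set Plane)) (δ : ℝ)
    (K : Finset (Fin 2 → ℤ)) (a : K → ℂ) :
    MemLp (fun p => if h : gridIndex δ p ∈ K then a ⟨_, h⟩ else 0) 2
      (volume.restrict (Ω : Set Plane)) := by
  have : IsFiniteMeasure (volume.restrict (Ω : Set Plane)) :=
    isFiniteMeasure_restrict.2 hb.measure_lt_top.ne
  refine MemLp.of_bound ?_ ‖a‖ (Eventually.of_forall fun p => ?_)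
  · have h1 : Measurable fun k : Fin 2 → ℤ => if h : k ∈ K then a ⟨k, h⟩ else 0 :=
      measurable_of_countable _
    exact (h1.comp (measurable_gridIndex δ)).aestronglyMeasurable
  · split_ifs with h
    · exact norm_le_pi_norm a _
    · simp

/-- The functions in `L²(Ω)` that are constant on the cells of a grid with index in `K` and zero
elsewhere, parametrised by their values. -/
noncomputable def stepMap {Ω : Opens Plane} (hb : Bornology.IsBounded (Ω : Set Plane)) (δ : ℝ)
    (K : Finset (Fin 2 → ℤ)) : (K → ℂ) →ₗ[ℂ] L2 Ω where
  toFun a := (memLp_step hb δ K a).toLp _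
  map_add' a b := by
    rw [← MemLp.toLp_add]
    refine MemLp.toLp_congr _ _ (Eventually.of_forall fun p => ?_)
    simp only [Pi.add_apply]
    split_ifs <;> simp
  map_smul' z a := by
    rw [RingHom.id_apply, ← MemLp.toLp_const_smul]
    refine MemLp.toLp_congr _ _ (Eventually.of_forall fun p => ?_)
    simp only [Pi.smul_apply]
    split_ifs <;> simp

/-- Rellich's theorem for test functions: bounded sets for the gradient norm are totally bounded
in `L²`. -/
theorem totallyBounded_testFunctions {Ω : Opens Plane}
    (hb : Bornology.IsBounded (Ω : Set Plane)) (C : ℝ) :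
    TotallyBounded {u : L2 Ω | ∃ φ : 𝓓(Ω, ℂ), toL2 Ω φ = u ∧ ‖u‖ ≤ 1 ∧
      ‖toL2 Ω (partialDeriv Ω ex φ)‖ ^ 2 + ‖toL2 Ω (partialDeriv Ω ey φ)‖ ^ 2 ≤ C} := by
  refine totallyBounded_of_finiteDimensional_approx (R := 1) ?_ fun ε hε => ?_
  · rintro u ⟨_, _, h, _⟩
    exact h
  set C' := max C 1 with hC'
  have hC'0 : 0 < C' := lt_of_lt_of_le one_pos (le_max_right _ _)
  set δ := ε / √(8 * C') with hδ
  have hδ0 : 0 < δ := by positivity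
  have hδε : 8 * δ ^ 2 * C' = ε ^ 2 := by
    rw [hδ, div_pow, Real.sq_sqrt (by positivity)]
    field_simp
  -- The cells that meet `Ω`: finitely many by boundedness, so the step functions form a
  -- finite-dimensional space.
  set K := (finite_gridIndex_image hb hδ0).toFinset with hK
  refine ⟨LinearMap.range (stepMap hb δ K), inferInstance, ?_⟩
  rintro _ ⟨φ, rfl, -, hφ⟩
  refine ⟨_, ⟨fun k => cellMean δ φ k, rfl⟩, ?_⟩
  have h1 := lintegral_sub_cellMean_le Ω hδ0 φ (hφ.trans (le_max_left C 1))
  rw [hδε] at h1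
  have h2 : toL2 Ω φ - stepMap hb δ K (fun k => cellMean δ φ k)
      = ((memLp_testFunction Ω φ).sub (memLp_step hb δ K fun k => cellMean δ φ k)).toLp _ := by
    rw [MemLp.toLp_sub (memLp_testFunction Ω φ) (memLp_step hb δ K fun k => cellMean δ φ k)]
    rfl
  have h3 : ‖toL2 Ω φ - stepMap hb δ K (fun k => cellMean δ φ k)‖ₑ ^ 2
      ≤ ENNReal.ofReal (ε ^ 2) := by
    rw [h2, Lp.enorm_toLp]
    have h4 := eLpNorm_nnreal_pow_eq_lintegral
      (f := (φ : Plane → ℂ) - fun p => if h : gridIndex δ p ∈ K then cellMean δ φ (gridIndex δ p)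
        else 0) (p := 2) (μ := volume.restrict (Ω : Set Plane)) (by norm_num)
    have h5 : eLpNorm ((φ : Plane → ℂ) - fun p => if h : gridIndex δ p ∈ K then
        cellMean δ φ (gridIndex δ p) else 0) 2 (volume.restrict (Ω : Set Plane)) ^ 2
        = ∫⁻ p in (Ω : Set Plane), ‖((φ : Plane → ℂ) - fun p => if h : gridIndex δ p ∈ K then
        cellMean δ φ (gridIndex δ p) else 0) p‖ₑ ^ 2 := by simpa using h4
    refine h5.trans_le (le_trans ?_ h1)
    refine le_trans ?_ (setLIntegral_le_lintegral (Ω : Set Plane) _)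
    refine setLIntegral_mono' Ω.isOpen.measurableSet fun p hp => ?_
    have hpK : gridIndex δ p ∈ K := by
      rw [hK, Set.Finite.mem_toFinset]
      exact ⟨p, hp, rfl⟩
    rw [Pi.sub_apply, dif_pos hpK]
  rw [← ofReal_norm, ← ENNReal.ofReal_pow (norm_nonneg _),
    ENNReal.ofReal_le_ofReal_iff (by positivity)] at h3
  exact (pow_le_pow_iff_left₀ (norm_nonneg _) hε.le two_ne_zero).1 h3

/-! ### The magnetic form and its gauge covariance -/

/-- The quadratic form of the Hamiltonian at a test function. -/
noncomputable def rotForm (Ω : Opens Plane) (ω : ℝ) (c : Plane) (φ : 𝓓(Ω, ℂ)) : ℝ :=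
  quadForm (minimalHamiltonian Ω ω c) ⟨toL2 Ω φ, LinearMap.mem_range_self _ φ⟩

/-- The magnetic derivative `∂ₓ + i (ω / 2) (y - y₀)`. -/
noncomputable def magneticX (Ω : Opens Plane) (ω : ℝ) (c : Plane) : 𝓓(Ω, ℂ) →ₗ[ℂ] 𝓓(Ω, ℂ) :=
  partialDeriv Ω ex + (Complex.I * (ω / 2 : ℝ)) • mulCoord Ω 1 (c 1)

/-- The magnetic derivative `∂ᵧ - i (ω / 2) (x - x₀)`. -/
noncomputable def magneticY (Ω : Opens Plane) (ω : ℝ) (c : Plane) : 𝓓(Ω, ℂ) →ₗ[ℂ] 𝓓(Ω, ℂ) :=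
  partialDeriv Ω ey - (Complex.I * (ω / 2 : ℝ)) • mulCoord Ω 0 (c 0)

theorem re_inner_self_eq {E : Type*} [NormedAddCommGroup E] [InnerProductSpace ℂ E] (x : E) :
    (inner ℂ x x).re = ‖x‖ ^ 2 := by
  rw [inner_self_eq_norm_sq_to_K]; norm_cast

theorem norm_add_I_smul_sq {E : Type*} [NormedAddCommGroup E] [InnerProductSpace ℂ E]
    (x y : E) (a : ℝ) :
    ‖x + (Complex.I * a) • y‖ ^ 2 = ‖x‖ ^ 2 - 2 * a * (inner ℂ x y).im + a ^ 2 * ‖y‖ ^ 2 := by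
  have h1 : (inner ℂ x ((Complex.I * a) • y)).re = -(a * (inner ℂ x y).im) := by
    rw [inner_smul_right]
    simp
  have h2 := @norm_add_sq ℂ _ _ _ _ x ((Complex.I * a) • y)
  have h3 : RCLike.re (inner ℂ x ((Complex.I * a) • y)) = -(a * (inner ℂ x y).im) := h1
  rw [h2, h3, norm_smul, norm_mul, Complex.norm_I, one_mul, Complex.norm_real, mul_pow,
    Real.norm_eq_abs, sq_abs]
  ring

/-- Completion of the square in the quadratic form of the Hamiltonian. -/
theorem rotForm_eq (Ω : Opens Plane) (ω : ℝ) (c : Plane) (φ : 𝓓(Ω, ℂ)) :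
    rotForm Ω ω c φ = ‖toL2 Ω (magneticX Ω ω c φ)‖ ^ 2 + ‖toL2 Ω (magneticY Ω ω c φ)‖ ^ 2
      - ω ^ 2 / 4 * (‖toL2 Ω (mulCoord Ω 0 (c 0) φ)‖ ^ 2
        + ‖toL2 Ω (mulCoord Ω 1 (c 1) φ)‖ ^ 2) := by
  rw [rotForm, quadForm, minimalHamiltonian_apply]
  set F := toL2 Ω φ with hF
  set X := toL2 Ω (partialDeriv Ω ex φ) with hX
  set Y := toL2 Ω (partialDeriv Ω ey φ) with hY
  set M0 := toL2 Ω (mulCoord Ω 0 (c 0) φ) with hM0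
  set M1 := toL2 Ω (mulCoord Ω 1 (c 1) φ) with hM1
  have key : inner ℂ (toL2 Ω (rotExpr Ω ω c φ)) F
      = inner ℂ X X + inner ℂ Y Y
        + (-(Complex.I * ω)) * (inner ℂ Y M0 - inner ℂ X M1) := by
    simp only [rotExpr, LinearMap.add_apply, LinearMap.neg_apply, LinearMap.smul_apply,
      LinearMap.sub_apply, LinearMap.comp_apply, map_add, map_neg, map_sub, map_smul,
      inner_add_left, inner_neg_left, inner_sub_left, inner_smul_left, hF,
      inner_partialDeriv Ω ex (partialDeriv Ω ex φ), inner_partialDeriv Ω ey (partialDeriv Ω ey φ),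
      inner_mulCoord, map_mul, Complex.conj_I, Complex.conj_ofReal, hX, hY, hM0, hM1]
    ring
  have h1 : toL2 Ω (magneticX Ω ω c φ) = X + (Complex.I * (ω / 2 : ℝ)) • M1 := by
    rw [magneticX, LinearMap.add_apply, LinearMap.smul_apply, map_add, map_smul]
  have h2 : toL2 Ω (magneticY Ω ω c φ) = Y + (Complex.I * (-(ω / 2) : ℝ)) • M0 := by
    rw [magneticY, LinearMap.sub_apply, LinearMap.smul_apply, map_sub, map_smul, sub_eq_add_neg,
      ← neg_smul, Complex.ofReal_neg, mul_neg]
  have h3 : ((-(Complex.I * ω)) * (inner ℂ Y M0 - inner ℂ X M1)).re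
      = ω * ((inner ℂ Y M0).im - (inner ℂ X M1).im) := by
    simp
  rw [key, h1, h2, norm_add_I_smul_sq, norm_add_I_smul_sq, Complex.add_re, Complex.add_re, h3,
    re_inner_self_eq, re_inner_self_eq]
  ring

/-- The form bounds the gradient norm. -/
theorem gradient_sq_le (Ω : Opens Plane) (ω : ℝ) (c : Plane) {R : ℝ}
    (hR : ∀ i : Fin 2, ∀ p ∈ Ω, |p i - c i| ≤ R) (φ : 𝓓(Ω, ℂ)) :
    ‖toL2 Ω (partialDeriv Ω ex φ)‖ ^ 2 + ‖toL2 Ω (partialDeriv Ω ey φ)‖ ^ 2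
      ≤ 2 * rotForm Ω ω c φ + 2 * ω ^ 2 * R ^ 2 * ‖toL2 Ω φ‖ ^ 2 := by
  have b0 := norm_mulCoord_le Ω 0 (c 0) R (hR 0) φ
  have b1 := norm_mulCoord_le Ω 1 (c 1) R (hR 1) φ
  -- An ordinary derivative is a magnetic one up to a potential term, and that term is bounded on
  -- `Ω`.
  have hsq : ∀ (D X : L2 Ω) (M : L2 Ω) (a : ℝ), D = X + (Complex.I * a) • M →
      ‖X‖ ^ 2 ≤ 2 * ‖D‖ ^ 2 + 2 * a ^ 2 * ‖M‖ ^ 2 := by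
    intro D X M a h
    have h1 : X = D + (Complex.I * (-a : ℝ)) • M := by
      rw [h, Complex.ofReal_neg, mul_neg, neg_smul]
      abel
    have h2 : ‖X‖ ≤ ‖D‖ + |a| * ‖M‖ := by
      rw [h1]
      refine (norm_add_le _ _).trans_eq ?_
      rw [norm_smul, norm_mul, Complex.norm_I, one_mul, Complex.norm_real, norm_neg,
        Real.norm_eq_abs]
    have h3 := pow_le_pow_left₀ (norm_nonneg X) h2 2
    have h4 := sq_abs a
    nlinarith [sq_nonneg (‖D‖ - |a| * ‖M‖)]
  have h1 := hsq (toL2 Ω (magneticX Ω ω c φ)) (toL2 Ω (partialDeriv Ω ex φ))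
    (toL2 Ω (mulCoord Ω 1 (c 1) φ)) (ω / 2) (by
      rw [magneticX, LinearMap.add_apply, LinearMap.smul_apply, map_add, map_smul])
  have h2 := hsq (toL2 Ω (magneticY Ω ω c φ)) (toL2 Ω (partialDeriv Ω ey φ))
    (toL2 Ω (mulCoord Ω 0 (c 0) φ)) (-(ω / 2)) (by
      rw [magneticY, LinearMap.sub_apply, LinearMap.smul_apply, map_sub, map_smul, sub_eq_add_neg,
        ← neg_smul, Complex.ofReal_neg, mul_neg])
  have h3 := rotForm_eq Ω ω c φ
  have c0 := pow_le_pow_left₀ (norm_nonneg _) b0 2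
  have c1 := pow_le_pow_left₀ (norm_nonneg _) b1 2
  have e0 := mul_le_mul_of_nonneg_left c0 (sq_nonneg ω)
  have e1 := mul_le_mul_of_nonneg_left c1 (sq_nonneg ω)
  rw [h3]
  nlinarith

/-- Multiplication of a test function by the phase `p ↦ exp (i (a x + b y))`. -/
noncomputable def gauge (Ω : Opens Plane) (a b : ℝ) (φ : 𝓓(Ω, ℂ)) : 𝓓(Ω, ℂ) where
  toFun p := Complex.exp (Complex.I * ((a * p 0 + b * p 1 : ℝ) : ℂ)) * φ p
  contDiff' := by
    have h : ContDiff ℝ ((⊤ : ℕ∞) : WithTop ℕ∞) (fun p : Plane => a * p 0 + b * p 1) := by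
      fun_prop
    exact (contDiff_const.mul (Complex.ofRealCLM.contDiff.comp h)).cexp.mul φ.contDiff
  hasCompactSupport' := φ.hasCompactSupport.mul_left
  tsupport_subset' := tsupport_mul_subset_right.trans φ.tsupport_subset

theorem gauge_apply (Ω : Opens Plane) (a b : ℝ) (φ : 𝓓(Ω, ℂ)) (p : Plane) :
    gauge Ω a b φ p = Complex.exp (Complex.I * ((a * p 0 + b * p 1 : ℝ) : ℂ)) * φ p := rfl

theorem norm_phase (x : ℝ) : ‖Complex.exp (Complex.I * (x : ℂ))‖ = 1 := by
  rw [mul_comm]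
  exact Complex.norm_exp_ofReal_mul_I x

theorem norm_toL2_eq_of_norm_eq (Ω : Opens Plane) {φ ψ : 𝓓(Ω, ℂ)} (h : ∀ p, ‖φ p‖ = ‖ψ p‖) :
    ‖toL2 Ω φ‖ = ‖toL2 Ω ψ‖ := by
  have hle : ∀ {φ ψ : 𝓓(Ω, ℂ)}, (∀ p, ‖φ p‖ = ‖ψ p‖) → ‖toL2 Ω φ‖ ≤ ‖toL2 Ω ψ‖ := by
    intro φ ψ h
    refine Lp.norm_le_norm_of_ae_le ?_
    filter_upwards [coeFn_toL2 Ω φ, coeFn_toL2 Ω ψ] with p h1 h2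
    rw [h1, h2, h]
  exact le_antisymm (hle h) (hle fun p => (h p).symm)

theorem norm_toL2_gauge (Ω : Opens Plane) (a b : ℝ) (φ : 𝓓(Ω, ℂ)) :
    ‖toL2 Ω (gauge Ω a b φ)‖ = ‖toL2 Ω φ‖ :=
  norm_toL2_eq_of_norm_eq Ω fun p => by rw [gauge_apply, norm_mul, norm_phase, one_mul]

theorem gauge_gauge_neg (Ω : Opens Plane) (a b : ℝ) (φ : 𝓓(Ω, ℂ)) :
    gauge Ω a b (gauge Ω (-a) (-b) φ) = φ := by
  ext p
  rw [gauge_apply, gauge_apply, ← mul_assoc, ← Complex.exp_add, ← mul_add, ← Complex.ofReal_add]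
  have : a * p 0 + b * p 1 + (-a * p 0 + -b * p 1) = 0 := by ring
  rw [this]
  simp

theorem mulCoord_apply (Ω : Opens Plane) (i : Fin 2) (a : ℝ) (φ : 𝓓(Ω, ℂ)) (p : Plane) :
    mulCoord Ω i a φ p = ((p i - a : ℝ) : ℂ) * φ p := rfl

theorem partialDeriv_gauge (Ω : Opens Plane) (a b : ℝ) (v : Plane) (φ : 𝓓(Ω, ℂ)) (p : Plane) :
    partialDeriv Ω v (gauge Ω a b φ) p
      = Complex.exp (Complex.I * ((a * p 0 + b * p 1 : ℝ) : ℂ))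
        * (partialDeriv Ω v φ p + Complex.I * ((a * v 0 + b * v 1 : ℝ) : ℂ) * φ p) := by
  rw [partialDeriv_apply]
  refine HasLineDerivAt.lineDeriv ?_
  have h1 := hasLineDerivAt_testFunction Ω v φ p
  have h2 : HasDerivAt (fun t : ℝ => a * (p 0 + t * v 0) + b * (p 1 + t * v 1))
      (a * v 0 + b * v 1) 0 := by
    have := ((((hasDerivAt_id (0 : ℝ)).mul_const (v 0)).const_add (p 0)).const_mul a).add
      ((((hasDerivAt_id (0 : ℝ)).mul_const (v 1)).const_add (p 1)).const_mul b)
    exact this.congr_deriv (by simp)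
  have h3 := ((h2.ofReal_comp).const_mul Complex.I).cexp.mul h1
  change HasDerivAt (fun t : ℝ => Complex.exp (Complex.I * ((a * (p + t • v) 0
    + b * (p + t • v) 1 : ℝ) : ℂ)) * φ (p + t • v)) _ 0
  refine (h3.congr_deriv ?_)
  simp only [zero_mul, zero_smul, add_zero]
  ring

/-- The phase has the constant gradient `(ω / 2) (d 1, -d 0)`, which cancels the change of the
vector potential caused by moving the centre by `d`. -/
theorem magneticX_gauge (Ω : Opens Plane) (ω : ℝ) (c d : Plane) (φ : 𝓓(Ω, ℂ)) :
    magneticX Ω ω (c + d) (gauge Ω (ω / 2 * d 1) (-(ω / 2 * d 0)) φ)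
      = gauge Ω (ω / 2 * d 1) (-(ω / 2 * d 0)) (magneticX Ω ω c φ) := by
  ext p
  rw [gauge_apply]
  change partialDeriv Ω ex _ p + (Complex.I * (ω / 2 : ℝ)) * mulCoord Ω 1 _ _ p
    = _ * (partialDeriv Ω ex φ p + (Complex.I * (ω / 2 : ℝ)) * mulCoord Ω 1 _ _ p)
  rw [partialDeriv_gauge, mulCoord_apply, mulCoord_apply, gauge_apply]
  simp only [PiLp.add_apply, PiLp.single_apply]
  simp
  ring

theorem magneticY_gauge (Ω : Opens Plane) (ω : ℝ) (c d : Plane) (φ : 𝓓(Ω, ℂ)) :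
    magneticY Ω ω (c + d) (gauge Ω (ω / 2 * d 1) (-(ω / 2 * d 0)) φ)
      = gauge Ω (ω / 2 * d 1) (-(ω / 2 * d 0)) (magneticY Ω ω c φ) := by
  ext p
  rw [gauge_apply]
  change partialDeriv Ω ey _ p - (Complex.I * (ω / 2 : ℝ)) * mulCoord Ω 0 _ _ p
    = _ * (partialDeriv Ω ey φ p - (Complex.I * (ω / 2 : ℝ)) * mulCoord Ω 0 _ _ p)
  rw [partialDeriv_gauge, mulCoord_apply, mulCoord_apply, gauge_apply]
  simp only [PiLp.add_apply, PiLp.single_apply]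
  simp
  ring

/-! ### First moments and their lower bound in a half-plane -/

/-- The first moment of `|φ|²` in the coordinate `i`, relative to `a`. -/
noncomputable def moment (Ω : Opens Plane) (i : Fin 2) (a : ℝ) (φ : 𝓓(Ω, ℂ)) : ℝ :=
  (inner ℂ (toL2 Ω (mulCoord Ω i a φ)) (toL2 Ω φ)).re

theorem norm_mulCoord_add_sq (Ω : Opens Plane) (i : Fin 2) (a d : ℝ) (φ : 𝓓(Ω, ℂ)) :
    ‖toL2 Ω (mulCoord Ω i (a + d) φ)‖ ^ 2
      = ‖toL2 Ω (mulCoord Ω i a φ)‖ ^ 2 - 2 * d * moment Ω i a φ + d ^ 2 * ‖toL2 Ω φ‖ ^ 2 := by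
  have h1 : mulCoord Ω i (a + d) φ = mulCoord Ω i a φ - (d : ℂ) • φ := by
    ext p
    change ((p i - (a + d) : ℝ) : ℂ) * φ p = ((p i - a : ℝ) : ℂ) * φ p - (d : ℂ) * φ p
    push_cast
    ring
  have h2 := @norm_sub_sq ℂ _ _ _ _ (toL2 Ω (mulCoord Ω i a φ)) ((d : ℂ) • toL2 Ω φ)
  have h3 : RCLike.re (inner ℂ (toL2 Ω (mulCoord Ω i a φ)) ((d : ℂ) • toL2 Ω φ))
      = d * moment Ω i a φ := by
    rw [inner_smul_right]
    exact Complex.re_ofReal_mul _ _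
  rw [h1, map_sub, map_smul, h2, h3, norm_smul, Complex.norm_real, mul_pow, Real.norm_eq_abs,
    sq_abs]
  ring

/-- The effect of a shift of the centre of rotation on the form, up to a gauge transformation. -/
theorem rotForm_add_gauge (Ω : Opens Plane) (ω : ℝ) (c d : Plane) (φ : 𝓓(Ω, ℂ)) :
    rotForm Ω ω (c + d) (gauge Ω (ω / 2 * d 1) (-(ω / 2 * d 0)) φ)
      = rotForm Ω ω c φ + ω ^ 2 / 4 * (2 * (d 0 * moment Ω 0 (c 0) φ + d 1 * moment Ω 1 (c 1) φ)
        - ‖d‖ ^ 2 * ‖toL2 Ω φ‖ ^ 2) := by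
  have hM : ∀ (i : Fin 2) (a b e : ℝ), ‖toL2 Ω (mulCoord Ω i a (gauge Ω b e φ))‖
      = ‖toL2 Ω (mulCoord Ω i a φ)‖ := fun i a b e => norm_toL2_eq_of_norm_eq Ω fun p => by
    rw [mulCoord_apply, mulCoord_apply, gauge_apply, norm_mul, norm_mul, norm_mul, norm_phase,
      one_mul]
  have hd : ‖d‖ ^ 2 = d 0 ^ 2 + d 1 ^ 2 := by
    rw [EuclideanSpace.norm_sq_eq, Fin.sum_univ_two, Real.norm_eq_abs, Real.norm_eq_abs, sq_abs,
      sq_abs]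
  -- The magnetic terms are unchanged; only the centrifugal term sees the shift.
  rw [rotForm_eq, rotForm_eq, magneticX_gauge, magneticY_gauge, norm_toL2_gauge,
    norm_toL2_gauge, hM, hM, PiLp.add_apply, PiLp.add_apply, norm_mulCoord_add_sq,
    norm_mulCoord_add_sq, hd]
  ring

theorem abs_moment_le (Ω : Opens Plane) (i : Fin 2) {a R : ℝ} (hR : ∀ p ∈ Ω, |p i - a| ≤ R)
    (φ : 𝓓(Ω, ℂ)) : |moment Ω i a φ| ≤ R * ‖toL2 Ω φ‖ ^ 2 := by
  refine (Complex.abs_re_le_norm _).trans ((norm_inner_le_norm _ _).trans ?_)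
  rw [sq, ← mul_assoc]
  exact mul_le_mul_of_nonneg_right (norm_mulCoord_le Ω i a R hR φ) (norm_nonneg _)

theorem integrable_mul_norm_sq (Ω : Opens Plane) (φ : 𝓓(Ω, ℂ)) {g : Plane → ℝ}
    (hg : Continuous g) : Integrable fun p => g p * ‖φ p‖ ^ 2 := by
  have hφ : Continuous φ := φ.continuous
  have h2 : HasCompactSupport fun p => ‖φ p‖ ^ 2 :=
    φ.hasCompactSupport.comp_left (g := fun z : ℂ => ‖z‖ ^ 2) (by simp)
  exact Continuous.integrable_of_hasCompactSupport (by fun_prop) h2.mul_left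

theorem norm_toL2_sq (Ω : Opens Plane) (φ : 𝓓(Ω, ℂ)) :
    ‖toL2 Ω φ‖ ^ 2 = ∫ p, ‖φ p‖ ^ 2 := by
  rw [← re_inner_self_eq, inner_toL2, ← RCLike.re_eq_complex_re,
    ← integral_re (integrable_conj_mul Ω φ φ)]
  refine integral_congr_ae (Eventually.of_forall fun p => ?_)
  simp only
  rw [← Complex.normSq_eq_conj_mul_self, RCLike.re_eq_complex_re, Complex.ofReal_re,
    Complex.normSq_eq_norm_sq]

theorem moment_eq_integral (Ω : Opens Plane) (i : Fin 2) (a : ℝ) (φ : 𝓓(Ω, ℂ)) :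
    moment Ω i a φ = ∫ p, (p i - a) * ‖φ p‖ ^ 2 := by
  rw [moment, inner_toL2, ← RCLike.re_eq_complex_re, ← integral_re (integrable_conj_mul Ω _ φ)]
  refine integral_congr_ae (Eventually.of_forall fun p => ?_)
  simp only
  rw [mulCoord_apply, map_mul (starRingEnd ℂ), Complex.conj_ofReal, mul_assoc,
    ← Complex.normSq_eq_conj_mul_self, RCLike.re_eq_complex_re, Complex.re_ofReal_mul,
    Complex.ofReal_re, Complex.normSq_eq_norm_sq]

theorem linear_moment_eq_integral (Ω : Opens Plane) (c v : Plane) (φ : 𝓓(Ω, ℂ)) :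
    v 0 * moment Ω 0 (c 0) φ + v 1 * moment Ω 1 (c 1) φ
      = ∫ p, (v 0 * (p 0 - c 0) + v 1 * (p 1 - c 1)) * ‖φ p‖ ^ 2 := by
  rw [moment_eq_integral, moment_eq_integral, ← integral_const_mul, ← integral_const_mul,
    ← integral_add]
  · refine integral_congr_ae (Eventually.of_forall fun p => ?_)
    simp only
    ring
  · exact (integrable_mul_norm_sq Ω φ (by fun_prop)).const_mul _
  · exact (integrable_mul_norm_sq Ω φ (by fun_prop)).const_mul _

theorem linear_moment_nonneg (Ω : Opens Plane) {c v : Plane}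
    (hv : ∀ p ∈ Ω, 0 < v 0 * (p 0 - c 0) + v 1 * (p 1 - c 1)) (φ : 𝓓(Ω, ℂ)) :
    0 ≤ v 0 * moment Ω 0 (c 0) φ + v 1 * moment Ω 1 (c 1) φ := by
  rw [linear_moment_eq_integral]
  refine integral_nonneg fun p => ?_
  by_cases hp : p ∈ Ω
  · exact mul_nonneg (hv p hp).le (sq_nonneg _)
  · simp [eq_zero_of_notMem Ω φ hp]

theorem integral_translate_sub_le (Ω : Opens Plane) (φ : 𝓓(Ω, ℂ)) (h : Plane) {C : ℝ}
    (hC : ‖toL2 Ω (partialDeriv Ω ex φ)‖ ^ 2 + ‖toL2 Ω (partialDeriv Ω ey φ)‖ ^ 2 ≤ C) :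
    Integrable (fun p => ‖φ (p + h) - φ p‖ ^ 2) ∧
      ∫ p, ‖φ (p + h) - φ p‖ ^ 2 ≤ ‖h‖ ^ 2 * C := by
  have hC0 : 0 ≤ C := le_trans (by positivity) hC
  have h1 := lintegral_translate_sub_le' Ω φ h hC
  have hφ : Continuous φ := φ.continuous
  have hc : Continuous fun p => ‖φ (p + h) - φ p‖ ^ 2 := by fun_prop
  have h2 : ∫⁻ p, ‖φ (p + h) - φ p‖ₑ ^ 2 = ∫⁻ p, ENNReal.ofReal (‖φ (p + h) - φ p‖ ^ 2) :=
    lintegral_congr fun p => by rw [ENNReal.ofReal_pow (norm_nonneg _), ofReal_norm]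
  rw [h2] at h1
  have hnn : 0 ≤ᵐ[volume] fun p => ‖φ (p + h) - φ p‖ ^ 2 :=
    Eventually.of_forall fun p => sq_nonneg _
  refine ⟨⟨hc.aestronglyMeasurable, ?_⟩, ?_⟩
  · rw [hasFiniteIntegral_iff_ofReal hnn]
    exact h1.trans_lt ENNReal.ofReal_lt_top
  · rw [integral_eq_lintegral_of_nonneg_ae hnn hc.aestronglyMeasurable]
    exact ENNReal.toReal_le_of_le_ofReal (by positivity) h1

/-- In a half-plane, functions with bounded gradient do not concentrate at the boundary. -/
theorem linear_moment_lower_bound (Ω : Opens Plane) {c v : Plane}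
    (hv : ∀ p ∈ Ω, 0 < v 0 * (p 0 - c 0) + v 1 * (p 1 - c 1)) {τ : ℝ} (hτ : 0 < τ)
    (φ : 𝓓(Ω, ℂ)) {C : ℝ}
    (hC : ‖toL2 Ω (partialDeriv Ω ex φ)‖ ^ 2 + ‖toL2 Ω (partialDeriv Ω ey φ)‖ ^ 2 ≤ C) :
    τ * ‖v‖ ^ 2 * (‖toL2 Ω φ‖ ^ 2 - τ ^ 2 * ‖v‖ ^ 2 * C)
      ≤ v 0 * moment Ω 0 (c 0) φ + v 1 * moment Ω 1 (c 1) φ := by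
  obtain ⟨hint, hle⟩ := integral_translate_sub_le Ω φ (-(τ • v)) hC
  have hn : ‖-(τ • v)‖ ^ 2 = τ ^ 2 * ‖v‖ ^ 2 := by
    rw [norm_neg, norm_smul, mul_pow, Real.norm_eq_abs, sq_abs]
  rw [hn] at hle
  have hv2 : ‖v‖ ^ 2 = v 0 ^ 2 + v 1 ^ 2 := by
    rw [EuclideanSpace.norm_sq_eq, Fin.sum_univ_two, Real.norm_eq_abs, Real.norm_eq_abs, sq_abs,
      sq_abs]
  set δ := τ * ‖v‖ ^ 2 with hδ
  have hδ0 : 0 ≤ δ := by positivity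
  have hs := integrable_mul_norm_sq Ω φ
    (g := fun p => v 0 * (p 0 - c 0) + v 1 * (p 1 - c 1)) (by fun_prop)
  -- Translation by `-τ v` lowers the linear function by `δ = τ ‖v‖²`. Where it is at least `δ`, the
  -- first term suffices; points of `Ω` in the remaining strip are moved out of `Ω`, so the
  -- difference there is `φ p` up to sign.
  have hpt : ∀ p, δ * ‖φ p‖ ^ 2 ≤ (v 0 * (p 0 - c 0) + v 1 * (p 1 - c 1)) * ‖φ p‖ ^ 2
      + δ * ‖φ (p + -(τ • v)) - φ p‖ ^ 2 := by
    intro p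
    by_cases hp : p ∈ Ω
    · have h1 := hv p hp
      rcases le_or_gt δ (v 0 * (p 0 - c 0) + v 1 * (p 1 - c 1)) with h2 | h2
      · have h3 := mul_le_mul_of_nonneg_right h2 (sq_nonneg ‖φ p‖)
        have h4 : 0 ≤ δ * ‖φ (p + -(τ • v)) - φ p‖ ^ 2 := by positivity
        linarith
      · have h3 : p + -(τ • v) ∉ Ω := fun h => by
          have h4 := hv _ h
          simp only [PiLp.add_apply, PiLp.neg_apply, PiLp.smul_apply, smul_eq_mul] at h4
          rw [hδ, hv2] at h2
          nlinarith
        rw [eq_zero_of_notMem Ω φ h3, zero_sub, norm_neg]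
        have := mul_nonneg h1.le (sq_nonneg ‖φ p‖)
        linarith
    · rw [eq_zero_of_notMem Ω φ hp, norm_zero]
      have : 0 ≤ δ * ‖φ (p + -(τ • v)) - 0‖ ^ 2 := by positivity
      linarith
  have h1 : ∫ p, δ * ‖φ p‖ ^ 2 ≤ _ :=
    integral_mono (integrable_mul_norm_sq Ω φ (g := fun _ => δ) continuous_const)
      (hs.add (hint.const_mul δ)) hpt
  rw [integral_add' hs (hint.const_mul δ), integral_const_mul, integral_const_mul,
    ← norm_toL2_sq, ← linear_moment_eq_integral] at h1
  have h2 := mul_le_mul_of_nonneg_left hle hδ0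
  rw [mul_sub]
  linarith

/-! ### The ground state energy as the bottom of the form -/

theorem exists_testFunction_ne_zero {Ω : Opens Plane} (hne : (Ω : Set Plane).Nonempty) :
    ∃ φ : 𝓓(Ω, ℂ), toL2 Ω φ ≠ 0 := by
  obtain ⟨x, hx⟩ := hne
  obtain ⟨f, hf1, hf2, hf3, -, hf5⟩ := exists_contDiff_tsupport_subset (n := ⊤)
    (Ω.isOpen.mem_nhds hx)
  let φ : 𝓓(Ω, ℂ) :=
    { toFun := fun p => (f p : ℂ)
      contDiff' := Complex.ofRealCLM.contDiff.comp hf3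
      hasCompactSupport' := hf2.comp_left Complex.ofReal_zero
      tsupport_subset' := (tsupport_comp_subset Complex.ofReal_zero f).trans hf1 }
  refine ⟨φ, fun h => ?_⟩
  have h1 : φ = 0 := toL2_injective Ω (h.trans (map_zero _).symm)
  have h2 : φ x = 0 := by rw [h1]; rfl
  have h3 : φ x = ((f x : ℝ) : ℂ) := rfl
  rw [h3, hf5] at h2
  simp at h2

theorem exists_coord_bound {Ω : Opens Plane} (hb : Bornology.IsBounded (Ω : Set Plane))
    (c : Plane) : ∃ R : ℝ, 0 < R ∧ ∀ i : Fin 2, ∀ p ∈ Ω, |p i - c i| ≤ R := by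
  obtain ⟨R, hR0, hR⟩ := hb.subset_closedBall_lt 0 c
  refine ⟨R, hR0, fun i p hp => ?_⟩
  have h1 := hR hp
  rw [Metric.mem_closedBall, dist_eq_norm] at h1
  exact (PiLp.norm_apply_le (p - c) i).trans h1

/-- The bottom of the form of the Hamiltonian. -/
noncomputable def rotBottom (Ω : Opens Plane) (ω : ℝ) (c : Plane) : ℝ :=
  bottom (minimalHamiltonian Ω ω c)

theorem exists_convergent_subseq {Ω : Opens Plane} (hb : Bornology.IsBounded (Ω : Set Plane))
    (ω : ℝ) (c : Plane) (C : ℝ) (s : ℕ → (minimalHamiltonian Ω ω c).domain)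
    (hs : ∀ n, ‖(s n : L2 Ω)‖ = 1) (hC : ∀ n, quadForm (minimalHamiltonian Ω ω c) (s n) ≤ C) :
    ∃ (u : L2 Ω) (k : ℕ → ℕ), StrictMono k ∧
      Tendsto (fun n => (s (k n) : L2 Ω)) atTop (𝓝 u) := by
  obtain ⟨R, -, hR⟩ := exists_coord_bound hb c
  have hK : IsCompact (closure {u : L2 Ω | ∃ φ : 𝓓(Ω, ℂ), toL2 Ω φ = u ∧ ‖u‖ ≤ 1 ∧
      ‖toL2 Ω (partialDeriv Ω ex φ)‖ ^ 2 + ‖toL2 Ω (partialDeriv Ω ey φ)‖ ^ 2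
        ≤ 2 * C + 2 * ω ^ 2 * R ^ 2}) :=
    (totallyBounded_testFunctions hb _).closure.isCompact_of_isClosed
      isClosed_closure
  obtain ⟨u, -, k, hk, hu⟩ := hK.tendsto_subseq (x := fun n => (s n : L2 Ω)) fun n => by
    refine subset_closure ?_
    obtain ⟨φ, hφ⟩ : ∃ φ, toL2 Ω φ = (s n : L2 Ω) := (s n).2
    refine ⟨φ, hφ, (hs n).le, (gradient_sq_le Ω ω c hR φ).trans ?_⟩
    have h1 : rotForm Ω ω c φ ≤ C := by
      have h2 : s n = ⟨toL2 Ω φ, LinearMap.mem_range_self _ φ⟩ := Subtype.ext hφ.symm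
      have h3 := hC n
      rwa [h2] at h3
    rw [hφ, hs n, one_pow, mul_one]
    linarith
  exact ⟨u, k, hk, hu⟩

theorem isLeast_rotBottom {Ω : Opens Plane} (hb : Bornology.IsBounded (Ω : Set Plane))
    (hne : (Ω : Set Plane).Nonempty) (ω : ℝ) (c : Plane) :
    IsLeast (eigenvalues Ω hb ω c) (rotBottom Ω ω c) := by
  obtain ⟨φ, hφ⟩ := exists_testFunction_ne_zero hne
  exact isLeast_bottom (minimalHamiltonian_semibounded Ω hb ω c) (minimalHamiltonian_dense Ω ω c)
    ⟨⟨toL2 Ω φ, LinearMap.mem_range_self _ φ⟩, hφ⟩ (exists_convergent_subseq hb ω c)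

theorem rotBottom_le_rotForm {Ω : Opens Plane} (hb : Bornology.IsBounded (Ω : Set Plane))
    (ω : ℝ) (c : Plane) {φ : 𝓓(Ω, ℂ)} (hφ : ‖toL2 Ω φ‖ = 1) :
    rotBottom Ω ω c ≤ rotForm Ω ω c φ := by
  have h := bottom_mul_le (minimalHamiltonian_semibounded Ω hb ω c)
    ⟨toL2 Ω φ, LinearMap.mem_range_self _ φ⟩
  change _ * ‖toL2 Ω φ‖ ^ 2 ≤ _ at h
  rwa [hφ, one_pow, mul_one] at h

theorem le_rotBottom {Ω : Opens Plane} (hne : (Ω : Set Plane).Nonempty) {ω : ℝ} {c : Plane}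
    {r : ℝ} (h : ∀ φ : 𝓓(Ω, ℂ), ‖toL2 Ω φ‖ = 1 → r ≤ rotForm Ω ω c φ) :
    r ≤ rotBottom Ω ω c := by
  obtain ⟨φ, hφ⟩ := exists_testFunction_ne_zero hne
  refine le_bottom ⟨⟨toL2 Ω φ, LinearMap.mem_range_self _ φ⟩, hφ⟩ ?_
  rintro ⟨_, ψ, rfl⟩ hψ
  exact h ψ hψ

/-! ### Dependence on the centre: continuity and existence of a maximum -/

/-- Gauged trial functions for the centre `c` are used at `c + d`; each of the two coordinate
moments contributes at most `2 R ‖d‖`. Exchanging the two centres gives continuity, and the term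
`-‖d‖²` gives control at infinity. -/
theorem rotBottom_add_le {Ω : Opens Plane} (hb : Bornology.IsBounded (Ω : Set Plane))
    (hne : (Ω : Set Plane).Nonempty) (ω : ℝ) (c d : Plane) {R : ℝ}
    (hR : ∀ i : Fin 2, ∀ p ∈ Ω, |p i - c i| ≤ R) :
    rotBottom Ω ω (c + d) ≤ rotBottom Ω ω c + ω ^ 2 / 4 * (4 * R * ‖d‖ - ‖d‖ ^ 2) := by
  rw [← sub_le_iff_le_add]
  refine le_rotBottom hne fun φ hφ => ?_
  have h1 := rotBottom_le_rotForm hb ω (c + d)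
    (φ := gauge Ω (ω / 2 * d 1) (-(ω / 2 * d 0)) φ) (by rw [norm_toL2_gauge, hφ])
  rw [rotForm_add_gauge, hφ, one_pow, mul_one] at h1
  have h2 : ∀ i : Fin 2, d i * moment Ω i (c i) φ ≤ ‖d‖ * R := by
    intro i
    have h3 := abs_moment_le Ω i (hR i) φ
    rw [hφ, one_pow, mul_one] at h3
    refine (le_abs_self _).trans ?_
    rw [abs_mul]
    exact mul_le_mul (PiLp.norm_apply_le d i) h3 (abs_nonneg _) (norm_nonneg _)
  have h3 : ω ^ 2 / 4 * (2 * (d 0 * moment Ω 0 (c 0) φ + d 1 * moment Ω 1 (c 1) φ) - ‖d‖ ^ 2)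
      ≤ ω ^ 2 / 4 * (4 * R * ‖d‖ - ‖d‖ ^ 2) := by
    refine mul_le_mul_of_nonneg_left ?_ (by positivity)
    linarith [h2 0, h2 1]
  linarith

theorem continuous_rotBottom {Ω : Opens Plane} (hb : Bornology.IsBounded (Ω : Set Plane))
    (hne : (Ω : Set Plane).Nonempty) (ω : ℝ) : Continuous (rotBottom Ω ω) := by
  rw [continuous_iff_continuousAt]
  intro c
  obtain ⟨R, -, hR⟩ := exists_coord_bound hb c
  have hbound : ∀ x, |rotBottom Ω ω x - rotBottom Ω ω c|
      ≤ ω ^ 2 / 4 * (4 * (R + ‖x - c‖) * ‖x - c‖ + ‖x - c‖ ^ 2) := by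
    intro x
    have hR' : ∀ i : Fin 2, ∀ p ∈ Ω, |p i - x i| ≤ R + ‖x - c‖ := by
      intro i p hp
      have h1 : |x i - c i| ≤ ‖x - c‖ := PiLp.norm_apply_le (x - c) i
      have h2 : p i - x i = (p i - c i) - (x i - c i) := by ring
      rw [h2]
      exact (abs_sub _ _).trans (add_le_add (hR i p hp) h1)
    have h1 := rotBottom_add_le hb hne ω c (x - c) hR
    have h2 := rotBottom_add_le hb hne ω x (c - x) hR'
    rw [add_sub_cancel] at h1 h2
    rw [norm_sub_rev c x] at h2
    have h3 : 0 ≤ ω ^ 2 / 4 * ‖x - c‖ ^ 2 := by positivity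
    rw [abs_le]
    constructor <;> nlinarith
  have hlim : Tendsto (fun x => ω ^ 2 / 4 * (4 * (R + ‖x - c‖) * ‖x - c‖ + ‖x - c‖ ^ 2))
      (𝓝 c) (𝓝 0) := by
    have : Continuous fun x => ω ^ 2 / 4 * (4 * (R + ‖x - c‖) * ‖x - c‖ + ‖x - c‖ ^ 2) := by
      fun_prop
    simpa using this.tendsto c
  rw [ContinuousAt, tendsto_iff_dist_tendsto_zero]
  exact squeeze_zero (fun _ => dist_nonneg) (fun x => by rw [Real.dist_eq]; exact hbound x) hlim

theorem exists_forall_rotBottom_le {Ω : Opens Plane} (hb : Bornology.IsBounded (Ω : Set Plane))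
    (hne : (Ω : Set Plane).Nonempty) (ω : ℝ) :
    ∃ c, ∀ c', rotBottom Ω ω c' ≤ rotBottom Ω ω c := by
  obtain ⟨R, hR0, hR⟩ := exists_coord_bound hb 0
  refine (continuous_rotBottom hb hne ω).exists_forall_ge' 0 ?_
  filter_upwards [(tendsto_norm_cocompact_atTop (E := Plane)).eventually_ge_atTop (4 * R)]
    with d hd
  have h1 := rotBottom_add_le hb hne ω 0 d hR
  rw [zero_add] at h1
  have h2 : ω ^ 2 / 4 * (4 * R * ‖d‖ - ‖d‖ ^ 2) ≤ 0 :=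
    mul_nonpos_of_nonneg_of_nonpos (by positivity) (by nlinarith [norm_nonneg d])
  linarith

/-! ### Maximum points lie in the region -/

/-- If the centre of rotation is separated from the region by a line, moving it towards the region
raises the bottom of the form. -/
theorem exists_rotBottom_lt {Ω : Opens Plane} (hb : Bornology.IsBounded (Ω : Set Plane))
    (hne : (Ω : Set Plane).Nonempty) {ω : ℝ} (hω : 0 < ω) {c v : Plane}
    (hv : ∀ p ∈ Ω, 0 < v 0 * (p 0 - c 0) + v 1 * (p 1 - c 1)) :
    ∃ c', rotBottom Ω ω c < rotBottom Ω ω c' := by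
  obtain ⟨R, -, hR⟩ := exists_coord_bound hb c
  have hv0 : 0 < ‖v‖ := by
    rw [norm_pos_iff]
    rintro rfl
    obtain ⟨p, hp⟩ := hne
    simpa using hv p hp
  set Λ := rotBottom Ω ω c with hΛ
  -- A gradient bound for unit vectors of energy below `Λ + 1`; the absolute value and the final 1
  -- only ensure positivity. The choice of `τ` then makes the moment of such vectors at least `m`.
  set C := |2 * (Λ + 1) + 2 * ω ^ 2 * R ^ 2| + 1 with hC
  have hC0 : 0 < C := by positivity
  set τ := (√(2 * ‖v‖ ^ 2 * C))⁻¹ with hτ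
  have hτ0 : 0 < τ := by positivity
  have hτ2 : τ ^ 2 * ‖v‖ ^ 2 * C = 1 / 2 := by
    rw [hτ, inv_pow, Real.sq_sqrt (by positivity)]
    field_simp
  set m := τ * ‖v‖ ^ 2 / 2 with hm
  have hm0 : 0 < m := by positivity
  -- The first bound keeps the quadratic loss below half of the guaranteed gain `2 t m` at low
  -- energy; the second keeps the loss below `1 / 4` at high energy.
  set t := min (τ / 2) (1 / (ω * ‖v‖)) with ht
  have ht0 : 0 < t := by positivity
  have ht1 : t * ‖v‖ ^ 2 ≤ m := by
    have h1 := mul_le_mul_of_nonneg_right (min_le_left (τ / 2) (1 / (ω * ‖v‖))) (sq_nonneg ‖v‖)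
    rw [hm]
    linarith
  have ht2 : ω ^ 2 / 4 * (t ^ 2 * ‖v‖ ^ 2) ≤ 1 / 4 := by
    have h1 : t * (ω * ‖v‖) ≤ 1 := by
      rw [← le_div_iff₀ (by positivity)]
      exact min_le_right _ _
    have h2 := pow_le_pow_left₀ (by positivity) h1 2
    nlinarith
  set η := min (1 / 2) (ω ^ 2 / 4 * (t * m)) with hη
  have hη0 : 0 < η := by positivity
  refine ⟨c + t • v, lt_of_lt_of_le (show Λ < Λ + η by linarith) (le_rotBottom hne fun ψ hψ => ?_)⟩
  set d : Plane := t • v with hd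
  set φ := gauge Ω (-(ω / 2 * d 1)) (-(-(ω / 2 * d 0))) ψ with hφ
  have hφ1 : ‖toL2 Ω φ‖ = 1 := by rw [hφ, norm_toL2_gauge, hψ]
  have hψφ : ψ = gauge Ω (ω / 2 * d 1) (-(ω / 2 * d 0)) φ := (gauge_gauge_neg Ω _ _ ψ).symm
  set M := v 0 * moment Ω 0 (c 0) φ + v 1 * moment Ω 1 (c 1) φ with hM
  have hform : rotForm Ω ω (c + d) ψ
      = rotForm Ω ω c φ + ω ^ 2 / 4 * (2 * t * M - t ^ 2 * ‖v‖ ^ 2) := by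
    rw [hψφ, rotForm_add_gauge, hφ1, hM, hd, norm_smul, mul_pow, Real.norm_eq_abs, sq_abs]
    simp only [PiLp.smul_apply, smul_eq_mul]
    ring
  have hM0 : 0 ≤ M := linear_moment_nonneg Ω hv φ
  have hq := rotBottom_le_rotForm hb ω c hφ1
  rw [hform]
  -- At high energy there is already a surplus of 1, of which at most `1 / 4` is lost. At low energy
  -- the moment bound yields the gain `ω² / 4 * (t * m)`.
  rcases le_or_gt (Λ + 1) (rotForm Ω ω c φ) with h | h
  · have h1 : 0 ≤ ω ^ 2 / 4 * (2 * t * M) := by positivity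
    have h2 : η ≤ 1 / 2 := min_le_left _ _
    linarith
  · have hg := gradient_sq_le Ω ω c hR φ
    rw [hφ1, one_pow, mul_one] at hg
    have hgC : ‖toL2 Ω (partialDeriv Ω ex φ)‖ ^ 2 + ‖toL2 Ω (partialDeriv Ω ey φ)‖ ^ 2 ≤ C := by
      have := le_abs_self (2 * (Λ + 1) + 2 * ω ^ 2 * R ^ 2)
      linarith
    have h1 := linear_moment_lower_bound Ω hv hτ0 φ hgC
    rw [hφ1, hτ2] at h1
    have h2 : m ≤ M := by
      rw [hm]
      linarith
    have h3 : η ≤ ω ^ 2 / 4 * (t * m) := min_le_right _ _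
    have h4 : ω ^ 2 / 4 * (t * m) ≤ ω ^ 2 / 4 * (2 * t * M - t ^ 2 * ‖v‖ ^ 2) := by
      refine mul_le_mul_of_nonneg_left ?_ (by positivity)
      nlinarith [mul_le_mul_of_nonneg_left h2 ht0.le, mul_le_mul_of_nonneg_left ht1 ht0.le]
    linarith

theorem mem_of_isMaximum_rotBottom {Ω : Opens Plane} (hb : Bornology.IsBounded (Ω : Set Plane))
    (hne : (Ω : Set Plane).Nonempty) (hconv : Convex ℝ (Ω : Set Plane)) {ω : ℝ} (hω : 0 < ω)
    {c : Plane} (hc : ∀ c', rotBottom Ω ω c' ≤ rotBottom Ω ω c) : c ∈ Ω := by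
  by_contra hcΩ
  -- Convexity enters here. Openness makes the separation strict even for `c` on the boundary.
  obtain ⟨f, hf⟩ := geometric_hahn_banach_point_open hconv Ω.isOpen hcΩ
  have hlin : ∀ h : Plane, f h = f ex * h 0 + f ey * h 1 := by
    intro h
    have : h = h 0 • ex + h 1 • ey := by
      ext i
      fin_cases i <;> simp
    conv_lhs => rw [this]
    rw [map_add, map_smul, map_smul, smul_eq_mul, smul_eq_mul]
    ring
  obtain ⟨c', hc'⟩ := exists_rotBottom_lt hb hne hω (c := c) (v := !₂[f ex, f ey])
    fun p hp => by
      have h1 := hf p hp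
      rw [hlin c, hlin p] at h1
      simp
      linarith
  exact absurd (hc c') (not_le.2 hc')

end RotatingFrame

theorem mainTheorem4 (Ω : Opens RotatingFrame.Plane)
    (hb : Bornology.IsBounded (Ω : Set RotatingFrame.Plane))
    (hne : (Ω : Set RotatingFrame.Plane).Nonempty)
    (hconv : Convex ℝ (Ω : Set RotatingFrame.Plane))
    (ω : ℝ) (hω : 0 < ω) :
    (∀ c : RotatingFrame.Plane,
      IsLeast (RotatingFrame.eigenvalues Ω hb ω c)
        (RotatingFrame.groundStateEigenvalue Ω hb ω c)) ∧
    (∃ c ∈ Ω, ∀ c' : RotatingFrame.Plane,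
      RotatingFrame.groundStateEigenvalue Ω hb ω c'
        ≤ RotatingFrame.groundStateEigenvalue Ω hb ω c) ∧
    (∀ c : RotatingFrame.Plane,
      (∀ c' : RotatingFrame.Plane,
        RotatingFrame.groundStateEigenvalue Ω hb ω c'
          ≤ RotatingFrame.groundStateEigenvalue Ω hb ω c) →
      c ∈ Ω) := by
  have hleast := RotatingFrame.isLeast_rotBottom hb hne ω
  have heq : ∀ c, RotatingFrame.groundStateEigenvalue Ω hb ω c = RotatingFrame.rotBottom Ω ω c :=
    fun c => (hleast c).csInf_eq
  simp only [heq]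
  refine ⟨hleast, ?_, fun c => RotatingFrame.mem_of_isMaximum_rotBottom hb hne hconv hω⟩
  obtain ⟨c, hc⟩ := RotatingFrame.exists_forall_rotBottom_le hb hne ω
  exact ⟨c, RotatingFrame.mem_of_isMaximum_rotBottom hb hne hconv hω hc, hc⟩
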